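/- Let $\omega_1,\omega_2,\gamma\in\mathbb{C}$ be such that $\delta=\omega_2/\omega_1$ satisfies ${\rm Im}\,\delta>0$ and $0<{\rm Im}\,\gamma<{\rm Im}\,\delta$. Let $$\zeta(z)=\frac1z+\sum_{(m,n)\in\mathbb{Z}^2\setminus\{(0,0)\}}\left\{\frac1{z-2m\omega_1-2n\omega_2}+\frac1{2m\omega_1+2n\omega_2}+\frac{z}{(2m\omega_1+2n\omega_2)^2}\right\}$$ be the Weierstrass zeta function, put $Z(u)=\zeta(2\omega_1u)$ and $(\Delta_\gamma Z)(u)=Z(u-\gamma)-2Z(u)+Z(u+\gamma)$, and consider, for functions $\eta(x,t)$ with $\eta(x+1,t)=\eta(x,t)$, $x\in\mathbb{R}$, the equation $$\frac{\partial}{\partial t}\eta(x,t)=\eta(x,t)\cdot\frac{i\omega_1}{\pi}\ \mathrm{p.v.}\!\!\int_{-1/2}^{1/2}(\Delta_\gamma Z)(y-x)\,\eta(y,t)\,dy,\qquad (\mathrm{ILW})$$ where p.v. is the Cauchy principal value at the points $y\in x+\mathbb{Z}$. For ${\rm Im}\,\Delta>0$ let $$\vartheta_1(u,\Delta)=-i\,e^{\pi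 i\Delta/4+\pi iu}\sum_{m\in\mathbb{Z}}(-1)^me^{\pi i\Delta m(m+1)+2\pi imu},$$ and let $\vartheta_1'$ denote its derivative in $u$. Let $\varepsilon,\Delta\in\mathbb{C}$ with ${\rm Im}\,\Delta>{\rm Im}\,\delta$ and let $k$ be a nonzero integer such that none of $k\gamma$, $k\delta$, $k(\delta-\gamma)$ lies in the lattice $\mathbb{Z}+\mathbb{Z}\Delta$, the zero set of $\vartheta_1(\cdot,\Delta)$ (this is automatic if $|k|=1$). Set $$\omega(k)=-\varepsilon\,\frac{\vartheta_1(k\gamma,\Delta)\,\vartheta_1(k(\delta-\gamma),\Delta)}{\vartheta_1'(0,\Delta)\,\vartheta_1(k\delta,\Delta)},\qquad \eta_0=\omega(k)\left(\frac{\vartheta_1'(k(\gamma-\delta),\Delta)}{\vartheta_1(k(\gamma-\delta),\Delta)}-\frac{\vartheta_1'(k\gamma,\Delta)}{\vartheta_1(k\gamma,\Delta)}\right),$$ $$\tau(x,t)=\vartheta_1(kx+\omega(k)t,\Delta),\qquad \eta(x,t)=\varepsilon\,\frac{\tau(x+\delta-\gamma,t)\,\tau(x+\gamma,t)}{\tau(x+\delta,t)\,\tau(x,t)}.$$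 (a) $\tau$ satisfies the bilinear equation: for all $x,t\in\mathbb{C}$, $$\partial_t\tau(x+\delta,t)\,\tau(x,t)-\tau(x+\delta,t)\,\partial_t\tau(x,t)=\varepsilon\,\tau(x+\delta-\gamma,t)\,\tau(x+\gamma,t)-\eta_0\,\tau(x+\delta,t)\,\tau(x,t).$$ (b) For every $t\in\mathbb{C}$ the function $z\mapsto\eta(z,t)$ is elliptic: it is meromorphic on $\mathbb{C}$ and has the periods $1$ and $\Delta/k$. (c) Let $U$ be the set of all $t\in\mathbb{C}$ for which $\tau(\cdot,t)$ has no zero in the closed strip $0\le{\rm Im}\,z\le{\rm Im}\,\delta$. For all $x\in\mathbb{R}$ and all $t\in U$ (in particular for all real $t\in U$), $\eta$ is analytic at $(x,t)$, $\eta(x+1,t)=\eta(x,t)$, the principal value exists, and $\eta$ satisfies (ILW) at $(x,t)$. The set $U$ is open, and it is nonempty if $\varepsilon\neq0$ and $|k|\,{\rm Im}\,\delta<{\rm Im}\,\Delta$. -/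

import Mathlib

open Complex Filter Topology MeasureTheory

namespace EllipticILW

noncomputable section

/-! ### The integro-differential equation -/

/-- The Weierstrass zeta function `ζ(z; 2ω₁, 2ω₂)` with half-periods `ω₁, ω₂`. -/
def weierstrassZeta (ω₁ ω₂ z : ℂ) : ℂ :=
  1 / z + ∑' v : {v : ℤ × ℤ // v ≠ 0},
    (1 / (z - (2 * v.1.1 * ω₁ + 2 * v.1.2 * ω₂)) + 1 / (2 * v.1.1 * ω₁ + 2 * v.1.2 * ω₂)
      + z / (2 * v.1.1 * ω₁ + 2 * v.1.2 * ω₂) ^ 2)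

/-- The discrete Laplacian `(Δ_γ f)(u) = f(u - γ) - 2 f(u) + f(u + γ)`. -/
def discreteLaplacian (γ : ℂ) (f : ℂ → ℂ) (u : ℂ) : ℂ :=
  f (u - γ) - 2 * f u + f (u + γ)

/-- The kernel: the second difference, with step `γ`, of the function `u ↦ ζ(2ω₁u; 2ω₁, 2ω₂)`
(which has periods `1` and `δ = ω₂/ω₁` up to additive constants). -/
def kernel (ω₁ ω₂ γ u : ℂ) : ℂ :=
  discreteLaplacian γ (fun s => weierstrassZeta ω₁ ω₂ (2 * ω₁ * s)) u

/-- The interval `[-1/2, 1/2]` with the `r`-neighbourhoods of the points `x + n`, `n ∈ ℤ`,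
taken out. -/
def truncatedPeriod (x r : ℝ) : Set ℝ :=
  {y | y ∈ Set.Icc (-1 / 2 : ℝ) (1 / 2) ∧ ∀ n : ℤ, r ≤ |y - (x + n)|}

/-- `v` is the Cauchy principal value of `∫_{-1/2}^{1/2} f(y) dy`, for a function `f` of period `1`
whose singularities are at the points `x + n`, `n ∈ ℤ`. -/
def HasPrincipalValue (x : ℝ) (f : ℝ → ℂ) (v : ℂ) : Prop :=
  (∀ r : ℝ, 0 < r → IntegrableOn f (truncatedPeriod x r)) ∧
    Tendsto (fun r : ℝ => ∫ y in truncatedPeriod x r, f y) (𝓝[>] 0) (𝓝 v)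

/-- `(𝖳 f)(x) = (i ω₁ / π) PV ∫_{-1/2}^{1/2} (Δ_γ ζ)(2ω₁(y - x)) f(y) dy` exists
and equals `v`. -/
def HasTransform (ω₁ ω₂ γ : ℂ) (f : ℝ → ℂ) (x : ℝ) (v : ℂ) : Prop :=
  ∃ p : ℂ, HasPrincipalValue x (fun y : ℝ => kernel ω₁ ω₂ γ ((y : ℂ) - (x : ℂ)) * f y) p ∧
    v = I * ω₁ / (Real.pi : ℂ) * p

/-- `η(x, t)` is an analytic solution, of period `1` in the real variable `x`, of
`∂η/∂t = η · 𝖳 η`, for all real `x` and all times `t` in `U`. Times may be complex; at a real time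
the complex derivative in `t` is in particular the real one. -/
structure IsILWSolution (ω₁ ω₂ γ : ℂ) (U : Set ℂ) (η : ℝ → ℂ → ℂ) : Prop where
  analytic : ∀ x : ℝ, ∀ t ∈ U, AnalyticAt ℝ (fun p : ℝ × ℂ => η p.1 p.2) (x, t)
  periodic : ∀ x : ℝ, ∀ t ∈ U, η (x + 1) t = η x t
  equation : ∀ x : ℝ, ∀ t ∈ U, ∃ v : ℂ,
    HasTransform ω₁ ω₂ γ (fun y => η y t) x v ∧ HasDerivAt (η x) (η x t * v) t

/-! ### The bilinear equation -/

/-- The Hirota derivative `D_t f · g = (∂_t f) g - f (∂_t g)`. -/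
def hirotaD (f g : ℂ → ℂ) (t : ℂ) : ℂ := deriv f t * g t - f t * deriv g t

/-- `D_t τ(x+δ) · τ(x) = ε τ(x+δ-γ) τ(x+γ) - η₀ τ(x+δ) τ(x)`. -/
structure IsBilinearSolution (γ δ ε η₀ : ℂ) (τ : ℂ → ℂ → ℂ) : Prop where
  differentiable : ∀ x : ℂ, Differentiable ℂ (τ x)
  equation : ∀ x t : ℂ, hirotaD (τ (x + δ)) (τ x) t
    = ε * (τ (x + δ - γ) t * τ (x + γ) t) - η₀ * (τ (x + δ) t * τ x t)

/-! ### The theta function and the elliptic solution -/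

/-- The theta function `ϑ₁(u, Δ)`. -/
def theta1 (u Δ : ℂ) : ℂ :=
  -I * exp (Real.pi * I * Δ / 4 + Real.pi * I * u) *
    ∑' m : ℤ, (-1 : ℂ) ^ m * exp (Real.pi * I * Δ * m * (m + 1) + 2 * Real.pi * I * m * u)

/-- The derivative `ϑ₁'(u, Δ)` in `u`. -/
def theta1' (u Δ : ℂ) : ℂ := deriv (fun s => theta1 s Δ) u

/-- The frequency `ω(k)`. -/
def omega (γ δ ε Δ : ℂ) (k : ℤ) : ℂ :=
  -ε * (theta1 (k * γ) Δ * theta1 (k * (δ - γ)) Δ / (theta1' 0 Δ * theta1 (k * δ) Δ))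

/-- The constant `η₀`. -/
def etaZero (γ δ ε Δ : ℂ) (k : ℤ) : ℂ :=
  omega γ δ ε Δ k * (theta1' (k * (γ - δ)) Δ / theta1 (k * (γ - δ)) Δ
    - theta1' (k * γ) Δ / theta1 (k * γ) Δ)

/-- `τ(x, t) = ϑ₁(k x + ω(k) t, Δ)`. -/
def tau (γ δ ε Δ : ℂ) (k : ℤ) (x t : ℂ) : ℂ := theta1 (k * x + omega γ δ ε Δ k * t) Δ

/-- `η(x, t) = ε τ(x+δ-γ) τ(x+γ) / (τ(x+δ) τ(x))`. -/
def eta (γ δ ε Δ : ℂ) (k : ℤ) (x t : ℂ) : ℂ :=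
  ε * (tau γ δ ε Δ k (x + δ - γ) t * tau γ δ ε Δ k (x + γ) t
    / (tau γ δ ε Δ k (x + δ) t * tau γ δ ε Δ k x t))

/-- The times `t` at which `τ(·, t)` has no zero in the closed strip `0 ≤ Im z ≤ Im δ`, so that
`w = -∂_t τ / τ` is holomorphic on a neighbourhood of that strip. -/
def regularTimes (δ : ℂ) (τ : ℂ → ℂ → ℂ) : Set ℂ :=
  {t | ∀ z : ℂ, 0 ≤ z.im → z.im ≤ δ.im → τ z t ≠ 0}

end

end EllipticILW

/-!
Up to a constant, `ϑ₁` is the product of the Jacobi triple product formula, so its zeros are simple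
and are exactly the points of `ℤ + ℤΔ`. The bilinear equation is an addition formula for `ϑ₁`: as
functions of `x` both of its sides have the multipliers of `ϑ₁(x) ϑ₁(x + y + z)`, and their
difference vanishes at the zeros of that product, hence by Liouville is a constant multiple of it;
the constant is zero because the difference vanishes at `x = -y`.

Divided by `τ(x + δ) τ(x)`, the bilinear equation reads `η(x) = w(x) - w(x + δ) + η₀`, where
`w = -∂_t τ / τ` is holomorphic on the strip `0 ≤ Im z ≤ Im δ`. The kernel `K = Δ_γ Z` has the
periods `1` and `δ`, so `K(y - x) (w(y) - w(y + δ))` is the difference of the boundary values of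
`K(z - x) w(z)`, and its principal value is a sum of residues in the strip: the poles `x + γ` and
`x + δ - γ` inside count fully, the poles `x` and `x + δ` on the boundary count by half. As `K` is
odd, `η₀` contributes nothing, and what is left is
`w(x) + w(x + δ) - w(x + γ) - w(x + δ - γ) = ∂_t log η(x)`.
-/

namespace EllipticILW

/-! ### Simple poles -/

/-- `f` has at most a simple pole at `p`, with residue `c`; the value `f p` is irrelevant. -/
def HasSimplePoleAt (f : ℂ → ℂ) (c p : ℂ) : Prop :=
  ∃ A : ℂ → ℂ, AnalyticAt ℂ A p ∧ ∀ᶠ z in 𝓝[≠] p, f z = c / (z - p) + A z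

section SimplePoles

variable {f g : ℂ → ℂ} {a b c d p : ℂ}

theorem hasSimplePoleAt_zero_of_analyticAt (hf : AnalyticAt ℂ f p) : HasSimplePoleAt f 0 p :=
  ⟨f, hf, by simp⟩

theorem hasSimplePoleAt_inv_sub (p : ℂ) : HasSimplePoleAt (fun z => 1 / (z - p)) 1 p :=
  ⟨0, analyticAt_const, by simp⟩

theorem HasSimplePoleAt.congr (hf : HasSimplePoleAt f c p) (hgf : ∀ᶠ z in 𝓝[≠] p, g z = f z) :
    HasSimplePoleAt g c p := by
  obtain ⟨A, hA, hfA⟩ := hf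
  exact ⟨A, hA, EventuallyEq.trans hgf hfA⟩

theorem HasSimplePoleAt.add (hf : HasSimplePoleAt f c p) (hg : HasSimplePoleAt g d p) :
    HasSimplePoleAt (fun z => f z + g z) (c + d) p := by
  obtain ⟨A, hA, hfA⟩ := hf
  obtain ⟨B, hB, hgB⟩ := hg
  refine ⟨fun z => A z + B z, hA.add hB, ?_⟩
  filter_upwards [hfA, hgB] with z hfz hgz
  rw [hfz, hgz]
  ring

theorem analyticAt_dslope (hg : AnalyticAt ℂ g p) : AnalyticAt ℂ (dslope g p) p := by
  obtain ⟨series, hseries⟩ := hg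
  exact ⟨_, hseries.has_fpower_series_dslope_fslope⟩

theorem HasSimplePoleAt.mul_analyticAt (hf : HasSimplePoleAt f c p) (hg : AnalyticAt ℂ g p) :
    HasSimplePoleAt (fun z => f z * g z) (c * g p) p := by
  obtain ⟨A, hA, hfA⟩ := hf
  have hslope := analyticAt_dslope hg
  refine ⟨fun z => c * dslope g p z + A z * g z, by fun_prop, ?_⟩
  filter_upwards [hfA, self_mem_nhdsWithin] with z hfz hz
  have hzp : z - p ≠ 0 := sub_ne_zero.2 hz
  rw [hfz, dslope_of_ne _ hz, slope_def_field]
  field_simp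
  ring

theorem HasSimplePoleAt.const_mul (hf : HasSimplePoleAt f c p) (a : ℂ) :
    HasSimplePoleAt (fun z => a * f z) (a * c) p := by
  simpa only [mul_comm] using hf.mul_analyticAt (g := fun _ => a) analyticAt_const

theorem HasSimplePoleAt.sub (hf : HasSimplePoleAt f c p) (hg : HasSimplePoleAt g d p) :
    HasSimplePoleAt (fun z => f z - g z) (c - d) p := by
  simpa only [sub_eq_add_neg, neg_one_mul] using hf.add (hg.const_mul (-1))

theorem HasSimplePoleAt.comp_add_const (hf : HasSimplePoleAt f c (p + b)) :
    HasSimplePoleAt (fun z => f (z + b)) c p := by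
  obtain ⟨A, hA, hfA⟩ := hf
  rw [← map_add_right_nhdsNE, eventually_map] at hfA
  refine ⟨fun z => A (z + b), AnalyticAt.fun_comp hA (by fun_prop), ?_⟩
  filter_upwards [hfA] with z hz
  rw [hz, add_sub_add_right_eq_sub]

theorem HasSimplePoleAt.div_of_simple_zero (hf : AnalyticAt ℂ f p) (hg : AnalyticAt ℂ g p)
    (hgp : g p = 0) (hderiv : deriv g p ≠ 0) :
    HasSimplePoleAt (fun z => f z / g z) (f p / deriv g p) p := by
  have hquot := (hasSimplePoleAt_inv_sub p).mul_analyticAt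
    (hf.fun_div (analyticAt_dslope hg) (by rwa [dslope_same]))
  rw [dslope_same, one_mul] at hquot
  refine hquot.congr ?_
  filter_upwards [self_mem_nhdsWithin] with z hz
  have hzp : z - p ≠ 0 := sub_ne_zero.2 hz
  rw [dslope_of_ne _ hz, slope_def_field, hgp, sub_zero]
  field_simp

/-- The function `f` with its removable singularities removed: its value at `z` is the limit of `f`
along the punctured neighbourhoods of `z` (a junk value where there is no limit). -/
noncomputable def regularize (f : ℂ → ℂ) (z : ℂ) : ℂ := limUnder (𝓝[≠] z) f

theorem regularize_eq_of_eventuallyEq {A : ℂ → ℂ} {z : ℂ} (hA : ContinuousAt A z)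
    (hfA : f =ᶠ[𝓝[≠] z] A) : regularize f z = A z :=
  ((hA.tendsto.mono_left nhdsWithin_le_nhds).congr' hfA.symm).limUnder_eq

theorem regularize_eq_self {z : ℂ} (hf : ContinuousAt f z) : regularize f z = f z :=
  regularize_eq_of_eventuallyEq hf .rfl

theorem HasSimplePoleAt.analyticAt_regularize (hf : HasSimplePoleAt f 0 p) :
    AnalyticAt ℂ (regularize f) p := by
  obtain ⟨A, hA, hfA⟩ := hf
  replace hfA : f =ᶠ[𝓝[≠] p] A := hfA.mono fun z hz => by rw [hz, zero_div, zero_add]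
  refine hA.congr ?_
  filter_upwards [eventually_nhdsWithin_iff.1 (eventually_eventually_nhdsWithin.2 hfA),
    hA.eventually_analyticAt] with z hfAz hAz
  refine (regularize_eq_of_eventuallyEq hAz.continuousAt ?_).symm
  rcases eq_or_ne z p with rfl | hzp
  · exact hfA
  · have hnear := hfAz hzp
    rw [isOpen_compl_singleton.nhdsWithin_eq hzp] at hnear
    exact hnear.filter_mono nhdsWithin_le_nhds

theorem regularize_add_of_eventuallyEq {z : ℂ} (hf : ∀ᶠ y in 𝓝[≠] z, f (y + a) = f y) :
    regularize f (z + a) = regularize f z := by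
  rw [regularize, regularize, limUnder, ← map_add_right_nhdsNE, Filter.map_map]
  exact congrArg lim (Filter.map_congr hf)

end SimplePoles

/-! ### Quasi-periodic functions -/

section Lattices

variable {δ γ u : ℂ}

theorem linearIndependent_one_of_im_pos (hδ : 0 < δ.im) :
    LinearIndependent ℝ ![(1 : ℂ), δ] := by
  refine LinearIndependent.pair_iff.2 fun s t hst => ?_
  have ht : t = 0 := by simpa [hδ.ne'] using congrArg Complex.im hst
  exact ⟨by simpa [ht] using congrArg Complex.re hst, ht⟩

/-- The pair of periods `1, δ` with `Im δ > 0`, generating the lattice `ℤ + ℤδ`. -/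
def unitPeriods (δ : ℂ) (hδ : 0 < δ.im) : PeriodPair where
  ω₁ := 1
  ω₂ := δ
  indep := linearIndependent_one_of_im_pos hδ

@[simp]
theorem unitPeriods_ω₁ {hδ : 0 < δ.im} : (unitPeriods δ hδ).ω₁ = 1 := rfl

@[simp]
theorem unitPeriods_ω₂ {hδ : 0 < δ.im} : (unitPeriods δ hδ).ω₂ = δ := rfl

theorem mem_lattice_unitPeriods {hδ : 0 < δ.im} :
    u ∈ (unitPeriods δ hδ).lattice ↔ ∃ m n : ℤ, u = m + n * δ := by
  simp only [PeriodPair.mem_lattice, unitPeriods_ω₁, unitPeriods_ω₂, mul_one, eq_comm]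

theorem notMem_lattice_of_im {hδ : 0 < δ.im} (hpos : 0 < u.im) (hlt : u.im < δ.im) :
    u ∉ (unitPeriods δ hδ).lattice := by
  rw [mem_lattice_unitPeriods]
  rintro ⟨m, n, rfl⟩
  have him : ((m : ℂ) + n * δ).im = n * δ.im := by simp
  rw [him] at hpos hlt
  have hn_pos : 0 < n := by exact_mod_cast pos_of_mul_pos_left hpos hδ.le
  have hn_lt : n < 1 := by exact_mod_cast (mul_lt_iff_lt_one_left hδ).1 hlt
  omega

theorem exists_eq_intCast_of_mem_lattice {hδ : 0 < δ.im} (hu : u ∈ (unitPeriods δ hδ).lattice)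
    (him : |u.im| < δ.im) : ∃ m : ℤ, u = m := by
  obtain ⟨m, n, rfl⟩ := mem_lattice_unitPeriods.1 hu
  have hn : |(n : ℝ)| < 1 := by
    refine (mul_lt_iff_lt_one_left hδ).1 ?_
    simpa [abs_mul, abs_of_pos hδ] using him
  obtain rfl : n = 0 := Int.abs_lt_one_iff.1 (by exact_mod_cast hn)
  exact ⟨m, by simp⟩

theorem one_mem_lattice {hδ : 0 < δ.im} : 1 ∈ (unitPeriods δ hδ).lattice :=
  (unitPeriods δ hδ).ω₁_mem_lattice

theorem period_mem_lattice {hδ : 0 < δ.im} : δ ∈ (unitPeriods δ hδ).lattice :=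
  (unitPeriods δ hδ).ω₂_mem_lattice

theorem intCast_mem_lattice {hδ : 0 < δ.im} (n : ℤ) : (n : ℂ) ∈ (unitPeriods δ hδ).lattice :=
  mem_lattice_unitPeriods.2 ⟨n, 0, by simp⟩

theorem countable_lattice (L : PeriodPair) : (L.lattice : Set ℂ).Countable :=
  Set.countable_coe_iff.1 (L.latticeEquivProd.toEquiv.countable_iff.2 inferInstance)

theorem periodic_of_mem_lattice {L : PeriodPair} {X : Type*} {H : ℂ → X}
    (h₁ : Function.Periodic H L.ω₁) (h₂ : Function.Periodic H L.ω₂) {l : ℂ}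
    (hl : l ∈ L.lattice) : Function.Periodic H l := by
  obtain ⟨m, n, rfl⟩ := PeriodPair.mem_lattice.1 hl
  exact (h₁.int_mul m).add_period (h₂.int_mul n)

theorem exists_eq_const_of_doublyPeriodic {L : PeriodPair} {H : ℂ → ℂ} (hH : Differentiable ℂ H)
    (h₁ : Function.Periodic H L.ω₁) (h₂ : Function.Periodic H L.ω₂) : ∃ c, ∀ z, H z = c := by
  refine hH.exists_const_forall_eq_of_bounded ?_
  have hbdd : Bornology.IsBounded (H '' closure (ZSpan.fundamentalDomain L.basis)) :=
    ((ZSpan.fundamentalDomain_isBounded L.basis).isCompact_closure.image hH.continuous).isBounded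
  refine hbdd.subset ?_
  rintro _ ⟨z, rfl⟩
  refine ⟨ZSpan.fract L.basis z, subset_closure (ZSpan.fract_mem_fundamentalDomain L.basis z), ?_⟩
  have hfloor : (ZSpan.floor L.basis z : ℂ) ∈ L.lattice := by
    rw [L.lattice_eq_span_range_basis]
    exact (ZSpan.floor L.basis z).2
  rw [ZSpan.fract_apply]
  exact (periodic_of_mem_lattice h₁ h₂ hfloor).sub_eq z

end Lattices

/-- `f` is quasi-periodic for the periods of `L`, with multipliers `e₁` and `e₂`. -/
structure IsQuasiPeriodic (L : PeriodPair) (e₁ e₂ f : ℂ → ℂ) : Prop where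
  add_ω₁ : ∀ z, f (z + L.ω₁) = e₁ z * f z
  add_ω₂ : ∀ z, f (z + L.ω₂) = e₂ z * f z

namespace IsQuasiPeriodic

variable {L : PeriodPair} {e₁ e₂ f g : ℂ → ℂ} {z l : ℂ}

theorem eq_zero_add_iff (hf : IsQuasiPeriodic L e₁ e₂ f) (he₁ : ∀ z, e₁ z ≠ 0)
    (he₂ : ∀ z, e₂ z ≠ 0) (hl : l ∈ L.lattice) (z : ℂ) : f (z + l) = 0 ↔ f z = 0 :=
  (periodic_of_mem_lattice (H := fun z => f z = 0)
    (fun z => by simp only [hf.add_ω₁, mul_eq_zero, he₁, false_or])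
    (fun z => by simp only [hf.add_ω₂, mul_eq_zero, he₂, false_or]) hl z).to_iff

theorem deriv_ne_zero_add_iff (hf : IsQuasiPeriodic L e₁ e₂ f) (hfd : Differentiable ℂ f)
    (he₁d : Differentiable ℂ e₁) (he₂d : Differentiable ℂ e₂)
    (he₁ : ∀ z, e₁ z ≠ 0) (he₂ : ∀ z, e₂ z ≠ 0) (hl : l ∈ L.lattice) (z : ℂ) :
    f (z + l) = 0 ∧ deriv f (z + l) ≠ 0 ↔ f z = 0 ∧ deriv f z ≠ 0 := by
  have hstep : ∀ {a : ℂ} {e : ℂ → ℂ}, Differentiable ℂ e → (∀ z, e z ≠ 0) →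
      (∀ z, f (z + a) = e z * f z) →
      Function.Periodic (fun z => f z = 0 ∧ deriv f z ≠ 0) a := by
    intro a e hed he hadd z
    have hderiv : deriv f (z + a) = deriv e z * f z + e z * deriv f z := by
      rw [← deriv_comp_add_const, ← deriv_fun_mul (hed z) (hfd z)]
      exact congrArg (deriv · z) (funext hadd)
    refine propext ?_
    change f (z + a) = 0 ∧ deriv f (z + a) ≠ 0 ↔ f z = 0 ∧ deriv f z ≠ 0
    rw [hadd, hderiv, mul_eq_zero, or_iff_right (he z)]
    refine and_congr_right fun hz => ?_
    rw [hz, mul_zero, zero_add, mul_ne_zero_iff, and_iff_right (he z)]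
  exact (periodic_of_mem_lattice (hstep he₁d he₁ hf.add_ω₁) (hstep he₂d he₂ hf.add_ω₂) hl z).to_iff

theorem div_periodic (hf : IsQuasiPeriodic L e₁ e₂ f) (hg : IsQuasiPeriodic L e₁ e₂ g)
    (he₁ : ∀ z, e₁ z ≠ 0) (he₂ : ∀ z, e₂ z ≠ 0) :
    Function.Periodic (fun z => f z / g z) L.ω₁ ∧ Function.Periodic (fun z => f z / g z) L.ω₂ :=
  ⟨fun z => by simp only [hf.add_ω₁, hg.add_ω₁, mul_div_mul_left _ _ (he₁ z)],
    fun z => by simp only [hf.add_ω₂, hg.add_ω₂, mul_div_mul_left _ _ (he₂ z)]⟩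

/-- The quotient of `f` by `g` is elliptic without poles. -/
theorem exists_eq_const_mul (hf : IsQuasiPeriodic L e₁ e₂ f) (hg : IsQuasiPeriodic L e₁ e₂ g)
    (he₁ : ∀ z, e₁ z ≠ 0) (he₂ : ∀ z, e₂ z ≠ 0)
    (hfd : Differentiable ℂ f) (hgd : Differentiable ℂ g)
    (hzeros : ∀ z, g z = 0 → f z = 0) (hsimple : ∀ z, g z = 0 → deriv g z ≠ 0) :
    ∃ c, ∀ z, f z = c * g z := by
  set h : ℂ → ℂ := fun z => f z / g z
  have hregular : ∀ z, g z ≠ 0 → AnalyticAt ℂ h z := fun z hz =>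
    (hfd.analyticAt z).fun_div (hgd.analyticAt z) hz
  have hremovable : ∀ z, HasSimplePoleAt h 0 z := by
    intro z
    by_cases hz : g z = 0
    · simpa only [hzeros z hz, zero_div] using
        HasSimplePoleAt.div_of_simple_zero (hfd.analyticAt z) (hgd.analyticAt z) hz (hsimple z hz)
    · exact hasSimplePoleAt_zero_of_analyticAt (hregular z hz)
  obtain ⟨hper₁, hper₂⟩ := hf.div_periodic hg he₁ he₂
  obtain ⟨c, hc⟩ := exists_eq_const_of_doublyPeriodic (L := L) (H := regularize h)
    (fun z => (hremovable z).analyticAt_regularize.differentiableAt)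
    (fun _ => regularize_add_of_eventuallyEq (.of_forall hper₁))
    (fun _ => regularize_add_of_eventuallyEq (.of_forall hper₂))
  refine ⟨c, fun z => ?_⟩
  by_cases hz : g z = 0
  · rw [hzeros z hz, hz, mul_zero]
  · rw [← hc z, regularize_eq_self (hregular z hz).continuousAt, div_mul_cancel₀ _ hz]

end IsQuasiPeriodic

/-! ### The theta function -/

/-- The `q`-Pochhammer symbol `(x; q)_∞ = ∏ (1 - q ^ n x)`, the product being over `n ≥ 0`. -/
noncomputable def qPochhammer (q x : ℂ) : ℂ := ∏' n : ℕ, (1 + -(q ^ n * x))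

/-- The modified theta function `(x; q)_∞ (q / x; q)_∞`, for `x ≠ 0`; its zeros are the powers
of `q`. -/
noncomputable def qTheta (q x : ℂ) : ℂ := qPochhammer q x * qPochhammer q (q / x)

section QTheta

variable {q x : ℂ}

theorem summable_norm_pow_mul (hq : ‖q‖ < 1) (x : ℂ) :
    Summable fun n : ℕ => ‖-(q ^ n * x)‖ := by
  simpa only [norm_neg, norm_mul, norm_pow] using
    (summable_geometric_of_lt_one (norm_nonneg q) hq).mul_right ‖x‖

theorem differentiable_qPochhammer (hq : ‖q‖ < 1) : Differentiable ℂ (qPochhammer q) := by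
  intro x
  have hconv : HasProdLocallyUniformlyOn (fun (n : ℕ) (y : ℂ) => 1 + -(q ^ n * y)) (qPochhammer q)
      (Metric.ball 0 (‖x‖ + 1)) := by
    refine Summable.hasProdLocallyUniformlyOn_nat_one_add Metric.isOpen_ball
      ((summable_geometric_of_lt_one (norm_nonneg q) hq).mul_right (‖x‖ + 1))
      (.of_forall fun n y hy => ?_) (fun n => by fun_prop)
    rw [mem_ball_zero_iff] at hy
    rw [norm_neg, norm_mul, norm_pow]
    gcongr
  have hdiff : DifferentiableOn ℂ (qPochhammer q) (Metric.ball 0 (‖x‖ + 1)) := by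
    refine hconv.differentiableOn (.of_forall fun s => ?_) Metric.isOpen_ball
    simpa [Finset.prod_fn] using DifferentiableOn.finsetProd fun _ _ => by fun_prop
  exact hdiff.differentiableAt (Metric.isOpen_ball.mem_nhds (by simp))

theorem qPochhammer_eq_mul (hq : ‖q‖ < 1) (x : ℂ) :
    qPochhammer q x = (1 - x) * qPochhammer q (q * x) := by
  have hshift : ∀ n : ℕ, 1 + -(q ^ n * (q * x)) = 1 + -(q ^ (n + 1) * x) := fun n => by ring
  have htail : Multipliable fun n : ℕ => 1 + -(q ^ (n + 1) * x) :=
    (multipliable_one_add_of_summable (summable_norm_pow_mul hq (q * x))).congr hshift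
  unfold qPochhammer
  rw [tprod_eq_zero_mul' (f := fun n : ℕ => 1 + -(q ^ n * x)) htail, tprod_congr hshift, pow_zero,
    one_mul, sub_eq_add_neg]

theorem exists_pow_mul_eq_one_of_qPochhammer_eq_zero (hq : ‖q‖ < 1) (hx : qPochhammer q x = 0) :
    ∃ n : ℕ, q ^ n * x = 1 := by
  by_contra! hne
  exact tprod_one_add_ne_zero_of_summable (f := fun n : ℕ => -(q ^ n * x))
    (fun n hn => hne n (by linear_combination -hn)) (summable_norm_pow_mul hq x) hx

theorem qPochhammer_self_ne_zero (hq : ‖q‖ < 1) : qPochhammer q q ≠ 0 := by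
  intro hzero
  obtain ⟨n, hn⟩ := exists_pow_mul_eq_one_of_qPochhammer_eq_zero hq hzero
  have hnorm : ‖q‖ ^ (n + 1) = 1 := by rw [← norm_pow, pow_succ, hn, norm_one]
  exact (pow_lt_one₀ (norm_nonneg q) hq n.succ_ne_zero).ne hnorm

theorem qTheta_eq_mul (hq : ‖q‖ < 1) (x : ℂ) :
    qTheta q x = (1 - x) * (qPochhammer q (q * x) * qPochhammer q (q / x)) := by
  rw [qTheta, qPochhammer_eq_mul hq x, mul_assoc]

theorem qTheta_mul_left (hq : ‖q‖ < 1) (hq₀ : q ≠ 0) (hx : x ≠ 0) :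
    qTheta q (q * x) = -x⁻¹ * qTheta q x := by
  rw [qTheta_eq_mul hq x, qTheta, div_mul_cancel_left₀ hq₀, qPochhammer_eq_mul hq x⁻¹,
    ← div_eq_mul_inv q x]
  linear_combination -qPochhammer q (q * x) * qPochhammer q (q / x) * inv_mul_cancel₀ hx

theorem exists_zpow_mul_eq_one_of_qTheta_eq_zero (hq : ‖q‖ < 1) (hq₀ : q ≠ 0) (hx : x ≠ 0)
    (hzero : qTheta q x = 0) : ∃ n : ℤ, q ^ n * x = 1 := by
  rcases mul_eq_zero.1 hzero with hleft | hright
  · obtain ⟨n, hn⟩ := exists_pow_mul_eq_one_of_qPochhammer_eq_zero hq hleft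
    exact ⟨n, by rwa [zpow_natCast]⟩
  · obtain ⟨n, hn⟩ := exists_pow_mul_eq_one_of_qPochhammer_eq_zero hq hright
    refine ⟨-(n + 1 : ℤ), ?_⟩
    rw [← mul_div_assoc, div_eq_one_iff_eq hx] at hn
    rw [zpow_neg, zpow_add_one₀ hq₀, zpow_natCast, hn, inv_mul_cancel₀ hx]

theorem hasDerivAt_qTheta_one (hq : ‖q‖ < 1) :
    HasDerivAt (qTheta q) (-qPochhammer q q ^ 2) 1 := by
  have hP := differentiable_qPochhammer hq
  have hfactor : DifferentiableAt ℂ (fun x => qPochhammer q (q * x) * qPochhammer q (q / x)) 1 := by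
    have hdiv : DifferentiableAt ℂ (fun x => q / x) 1 :=
      (differentiableAt_const q).div differentiableAt_id one_ne_zero
    fun_prop
  have hprod := ((hasDerivAt_id (1 : ℂ)).const_sub 1).fun_mul hfactor.hasDerivAt
  simp only [id, sub_self, zero_mul, add_zero, mul_one, div_one, neg_one_mul, ← sq] at hprod
  exact hprod.congr_of_eventuallyEq (.of_forall (qTheta_eq_mul hq))

end QTheta

/-- The character `e(u) = e^{2πiu}` of `ℂ/ℤ`. -/
noncomputable def expTwoPiI (u : ℂ) : ℂ := exp (2 * Real.pi * I * u)

section ExpTwoPiI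

variable {u : ℂ}

theorem hasDerivAt_expTwoPiI (u : ℂ) :
    HasDerivAt expTwoPiI (2 * Real.pi * I * expTwoPiI u) u := by
  refine ((hasDerivAt_id u).const_mul (2 * Real.pi * I : ℂ)).cexp.congr_deriv ?_
  rw [mul_one, mul_comm]
  rfl

@[fun_prop]
theorem differentiable_expTwoPiI : Differentiable ℂ expTwoPiI := fun u =>
  (hasDerivAt_expTwoPiI u).differentiableAt

theorem expTwoPiI_ne_zero (u : ℂ) : expTwoPiI u ≠ 0 := exp_ne_zero _

theorem expTwoPiI_zero : expTwoPiI 0 = 1 := by simp [expTwoPiI]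

theorem expTwoPiI_add (u v : ℂ) : expTwoPiI (u + v) = expTwoPiI u * expTwoPiI v := by
  rw [expTwoPiI, mul_add, exp_add, expTwoPiI, expTwoPiI]

theorem expTwoPiI_sub (u v : ℂ) : expTwoPiI (u - v) = expTwoPiI u / expTwoPiI v := by
  rw [expTwoPiI, mul_sub, exp_sub, expTwoPiI, expTwoPiI]

theorem expTwoPiI_int_mul (n : ℤ) (u : ℂ) : expTwoPiI (n * u) = expTwoPiI u ^ n := by
  rw [expTwoPiI, expTwoPiI, ← exp_int_mul, mul_left_comm]

theorem expTwoPiI_eq_one_iff : expTwoPiI u = 1 ↔ ∃ n : ℤ, u = n := by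
  refine exp_eq_one_iff.trans (exists_congr fun n => ?_)
  rw [mul_comm (n : ℂ)]
  exact mul_right_inj' two_pi_I_ne_zero

theorem expTwoPiI_periodic : Function.Periodic expTwoPiI 1 := fun u => by
  rw [expTwoPiI_add, expTwoPiI_eq_one_iff.2 ⟨1, Int.cast_one.symm⟩, mul_one]

theorem norm_expTwoPiI (u : ℂ) : ‖expTwoPiI u‖ = Real.exp (-(2 * Real.pi * u.im)) := by
  rw [expTwoPiI, norm_exp]
  simp

theorem norm_expTwoPiI_lt_one (hu : 0 < u.im) : ‖expTwoPiI u‖ < 1 := by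
  rw [norm_expTwoPiI, Real.exp_lt_one_iff, neg_lt_zero]
  exact mul_pos Real.two_pi_pos hu

end ExpTwoPiI

/-- The factor by which `ϑ₁(·, Δ)` is multiplied under the translation `u ↦ u + Δ`. -/
noncomputable def thetaMultiplier (Δ u : ℂ) : ℂ := -exp (-(Real.pi * I * Δ) - 2 * Real.pi * I * u)

theorem thetaMultiplier_ne_zero (Δ u : ℂ) : thetaMultiplier Δ u ≠ 0 :=
  neg_ne_zero.2 (exp_ne_zero _)

theorem hasDerivAt_thetaMultiplier (Δ u : ℂ) :
    HasDerivAt (thetaMultiplier Δ) (-(2 * Real.pi * I) * thetaMultiplier Δ u) u := by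
  have hlinear : HasDerivAt (fun u : ℂ => -(Real.pi * I * Δ) - 2 * Real.pi * I * u)
      (-(2 * Real.pi * I)) u := by
    simpa using ((hasDerivAt_id u).const_mul (2 * Real.pi * I)).const_sub (-(Real.pi * I * Δ))
  exact hlinear.cexp.fun_neg.congr_deriv (by rw [thetaMultiplier]; ring)

theorem differentiable_thetaMultiplier (Δ : ℂ) : Differentiable ℂ (thetaMultiplier Δ) :=
  fun u => (hasDerivAt_thetaMultiplier Δ u).differentiableAt

theorem thetaMultiplier_mul_of_add_eq {Δ a b s : ℂ} (h : a + b = s) (u : ℂ) :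
    thetaMultiplier Δ (u + a) * thetaMultiplier Δ (u + b)
      = thetaMultiplier Δ u * thetaMultiplier Δ (u + s) := by
  simp only [thetaMultiplier, neg_mul_neg, ← exp_add, ← h]
  ring_nf

/-- The product side of the Jacobi triple product for `ϑ₁`, up to a constant factor. -/
noncomputable def thetaProd (Δ u : ℂ) : ℂ :=
  exp (-(Real.pi * I * u)) * qTheta (expTwoPiI Δ) (expTwoPiI u)

section ThetaProd

variable {Δ : ℂ} (hΔ : 0 < Δ.im)
include hΔ

theorem differentiable_thetaProd : Differentiable ℂ (thetaProd Δ) := by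
  have hpoch := differentiable_qPochhammer (norm_expTwoPiI_lt_one hΔ)
  unfold thetaProd qTheta
  simp only [← expTwoPiI_sub]
  fun_prop

theorem isQuasiPeriodic_thetaProd :
    IsQuasiPeriodic (unitPeriods Δ hΔ) (fun _ => -1) (thetaMultiplier Δ) (thetaProd Δ) where
  add_ω₁ u := by
    have hsign : exp (-(Real.pi * I * (u + 1))) = -exp (-(Real.pi * I * u)) := by
      rw [mul_add, mul_one, neg_add, ← sub_eq_add_neg, exp_sub, exp_pi_mul_I, div_neg, div_one]
    rw [unitPeriods_ω₁, thetaProd, expTwoPiI_periodic, hsign, thetaProd]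
    ring
  add_ω₂ u := by
    have hexp : exp (-(Real.pi * I * (u + Δ))) * -(expTwoPiI u)⁻¹
        = thetaMultiplier Δ u * exp (-(Real.pi * I * u)) := by
      rw [thetaMultiplier, expTwoPiI, ← exp_neg, mul_neg, neg_mul, ← exp_add, ← exp_add]
      ring_nf
    rw [unitPeriods_ω₂, thetaProd, add_comm u Δ, expTwoPiI_add, qTheta_mul_left
      (norm_expTwoPiI_lt_one hΔ) (expTwoPiI_ne_zero Δ) (expTwoPiI_ne_zero u), add_comm Δ u,
      ← mul_assoc, hexp, mul_assoc, thetaProd]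

theorem mem_lattice_of_thetaProd_eq_zero {u : ℂ} (hu : thetaProd Δ u = 0) :
    u ∈ (unitPeriods Δ hΔ).lattice := by
  obtain ⟨n, hn⟩ := exists_zpow_mul_eq_one_of_qTheta_eq_zero (norm_expTwoPiI_lt_one hΔ)
    (expTwoPiI_ne_zero Δ) (expTwoPiI_ne_zero u) ((mul_eq_zero_iff_left (exp_ne_zero _)).1 hu)
  rw [← expTwoPiI_int_mul, ← expTwoPiI_add, expTwoPiI_eq_one_iff] at hn
  obtain ⟨m, hm⟩ := hn
  exact mem_lattice_unitPeriods.2 ⟨m, -n, by push_cast; linear_combination hm⟩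

theorem hasDerivAt_thetaProd_zero : HasDerivAt (thetaProd Δ)
    (-(2 * Real.pi * I) * qPochhammer (expTwoPiI Δ) (expTwoPiI Δ) ^ 2) 0 := by
  have hqTheta : HasDerivAt (fun u => qTheta (expTwoPiI Δ) (expTwoPiI u))
      (-qPochhammer (expTwoPiI Δ) (expTwoPiI Δ) ^ 2 * (2 * Real.pi * I * expTwoPiI 0)) 0 :=
    (hasDerivAt_qTheta_one (norm_expTwoPiI_lt_one hΔ)).comp_of_eq (0 : ℂ) (hasDerivAt_expTwoPiI 0)
      expTwoPiI_zero.symm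
  have hfactor : DifferentiableAt ℂ (fun u : ℂ => exp (-(Real.pi * I * u))) 0 := by fun_prop
  have hzero : qTheta (expTwoPiI Δ) 1 = 0 := by
    rw [qTheta_eq_mul (norm_expTwoPiI_lt_one hΔ), sub_self, zero_mul]
  refine (hfactor.hasDerivAt.fun_mul hqTheta).congr_deriv ?_
  simp only [expTwoPiI_zero, hzero, mul_zero, neg_zero, exp_zero]
  ring

theorem deriv_thetaProd_ne_zero {u : ℂ} (hu : thetaProd Δ u = 0) : deriv (thetaProd Δ) u ≠ 0 := by
  have hderiv_zero : deriv (thetaProd Δ) 0 ≠ 0 := by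
    rw [(hasDerivAt_thetaProd_zero hΔ).deriv]
    exact mul_ne_zero (neg_ne_zero.2 two_pi_I_ne_zero)
      (pow_ne_zero 2 (qPochhammer_self_ne_zero (norm_expTwoPiI_lt_one hΔ)))
  have hlattice := mem_lattice_of_thetaProd_eq_zero hΔ hu
  have hquasi := isQuasiPeriodic_thetaProd hΔ
  have hone : ∀ _ : ℂ, (-1 : ℂ) ≠ 0 := fun _ => neg_ne_zero.2 one_ne_zero
  have hzero : thetaProd Δ 0 = 0 := by
    rw [← hquasi.eq_zero_add_iff hone (thetaMultiplier_ne_zero Δ) hlattice, zero_add, hu]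
  have htranslate := hquasi.deriv_ne_zero_add_iff (differentiable_thetaProd hΔ)
    (differentiable_const _) (differentiable_thetaMultiplier Δ) hone (thetaMultiplier_ne_zero Δ)
    hlattice 0
  rw [zero_add] at htranslate
  exact (htranslate.2 ⟨hzero, hderiv_zero⟩).2

end ThetaProd

section Theta

variable {Δ : ℂ}

theorem theta1_eq_jacobiTheta₂ (u Δ : ℂ) :
    theta1 u Δ = -I * exp (Real.pi * I * Δ / 4 + Real.pi * I * u) *
      jacobiTheta₂ (u + (1 + Δ) / 2) Δ := by
  unfold theta1 jacobiTheta₂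
  congr 1
  refine tsum_congr fun m => ?_
  rw [jacobiTheta₂_term, ← exp_pi_mul_I, ← exp_int_mul, ← exp_add]
  ring_nf

theorem theta1_add_one (u Δ : ℂ) : theta1 (u + 1) Δ = -1 * theta1 u Δ := by
  rw [theta1_eq_jacobiTheta₂, theta1_eq_jacobiTheta₂, add_right_comm u 1, jacobiTheta₂_add_left,
    mul_add (Real.pi * I : ℂ) u, ← add_assoc, mul_one, exp_add _ (Real.pi * I), exp_pi_mul_I]
  ring

theorem neg_exp_eq_exp_pi_mul_I_add (a : ℂ) : -exp a = exp (Real.pi * I + a) := by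
  rw [exp_add, exp_pi_mul_I, neg_one_mul]

theorem theta1_add_period (u Δ : ℂ) :
    theta1 (u + Δ) Δ = thetaMultiplier Δ u * theta1 u Δ := by
  have hfactor : exp (Real.pi * I * Δ / 4 + Real.pi * I * (u + Δ)) *
      exp (-Real.pi * I * (Δ + 2 * (u + (1 + Δ) / 2))) =
      thetaMultiplier Δ u * exp (Real.pi * I * Δ / 4 + Real.pi * I * u) := by
    rw [thetaMultiplier, neg_exp_eq_exp_pi_mul_I_add, ← exp_add, ← exp_add, ← exp_periodic]
    ring_nf
  rw [theta1_eq_jacobiTheta₂, theta1_eq_jacobiTheta₂, add_right_comm u Δ, jacobiTheta₂_add_left']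
  linear_combination -I * jacobiTheta₂ (u + (1 + Δ) / 2) Δ * hfactor

theorem theta1_neg (u Δ : ℂ) : theta1 (-u) Δ = -theta1 u Δ := by
  have heven : jacobiTheta₂ (-u + (1 + Δ) / 2) Δ = jacobiTheta₂ (u - (1 + Δ) / 2) Δ := by
    rw [← jacobiTheta₂_neg_left]
    ring_nf
  have hshift : jacobiTheta₂ (u + (1 + Δ) / 2) Δ =
      exp (-Real.pi * I * (2 * u - 1)) * jacobiTheta₂ (u - (1 + Δ) / 2) Δ := by
    rw [show u + (1 + Δ) / 2 = u - (1 + Δ) / 2 + Δ + 1 by ring, jacobiTheta₂_add_left,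
      jacobiTheta₂_add_left']
    ring_nf
  have hfactor : exp (Real.pi * I * Δ / 4 + Real.pi * I * -u) =
      -(exp (Real.pi * I * Δ / 4 + Real.pi * I * u) * exp (-Real.pi * I * (2 * u - 1))) := by
    rw [← exp_add, neg_exp_eq_exp_pi_mul_I_add, ← exp_periodic]
    ring_nf
  rw [theta1_eq_jacobiTheta₂, theta1_eq_jacobiTheta₂, heven, hshift, hfactor]
  ring

theorem theta1_zero (Δ : ℂ) : theta1 0 Δ = 0 :=
  self_eq_neg.1 (by simpa only [neg_zero] using theta1_neg 0 Δ)

theorem integral_jacobiTheta₂_term (n : ℤ) (Δ : ℂ) :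
    ∫ x in (0 : ℝ)..1, jacobiTheta₂_term n x Δ = if n = 0 then 1 else 0 := by
  split_ifs with hn
  · simp [hn, jacobiTheta₂_term]
  · have hfreq : (2 * Real.pi * I * n : ℂ) ≠ 0 :=
      mul_ne_zero two_pi_I_ne_zero (Int.cast_ne_zero.2 hn)
    have hperiod : exp (2 * Real.pi * I * n * (1 : ℝ)) = 1 :=
      exp_eq_one_iff.2 ⟨n, by push_cast; ring⟩
    have hterm : ∀ x : ℝ, jacobiTheta₂_term n x Δ
        = exp (2 * Real.pi * I * n * x) * exp (Real.pi * I * n ^ 2 * Δ) :=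
      fun x => by rw [jacobiTheta₂_term, exp_add]
    simp only [hterm]
    rw [intervalIntegral.integral_mul_const, integral_exp_mul_complex hfreq, hperiod, ofReal_zero,
      mul_zero, exp_zero, sub_self, zero_div, zero_mul]

theorem integral_jacobiTheta₂ (hΔ : 0 < Δ.im) :
    ∫ x in (0 : ℝ)..1, jacobiTheta₂ x Δ = 1 := by
  let term : ℤ → C(ℝ, ℂ) := fun n =>
    ⟨fun x : ℝ => jacobiTheta₂_term n x Δ, by unfold jacobiTheta₂_term; fun_prop⟩
  have hsum : Summable fun n : ℤ => Real.exp (-Real.pi * n ^ 2 * Δ.im) := by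
    simpa [norm_jacobiTheta₂_term] using ((summable_jacobiTheta₂_term_iff 0 Δ).2 hΔ).norm
  have hintegral := intervalIntegral.hasSum_intervalIntegral_of_summable_norm (a := 0) (b := 1)
    (f := term) (hsum.of_nonneg_of_le (fun _ => norm_nonneg _) fun n =>
      (ContinuousMap.norm_le _ (Real.exp_nonneg _)).2 fun x => by
        simp [term, norm_jacobiTheta₂_term])
  simp only [term, ContinuousMap.coe_mk, integral_jacobiTheta₂_term] at hintegral
  exact hintegral.unique (hasSum_ite_eq 0 1)

theorem exists_theta1_ne_zero (hΔ : 0 < Δ.im) : ∃ u, theta1 u Δ ≠ 0 := by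
  by_contra! hzero
  have hjacobi : ∀ z, jacobiTheta₂ z Δ = 0 := fun z => by
    simpa [theta1_eq_jacobiTheta₂] using hzero (z - (1 + Δ) / 2)
  simpa [hjacobi] using integral_jacobiTheta₂ hΔ

theorem differentiable_theta1 (hΔ : 0 < Δ.im) : Differentiable ℂ (fun u => theta1 u Δ) := by
  have hjacobi : Differentiable ℂ fun z => jacobiTheta₂ z Δ :=
    fun z => differentiableAt_jacobiTheta₂_fst z hΔ
  simp only [theta1_eq_jacobiTheta₂]
  fun_prop

theorem isQuasiPeriodic_theta1 (hΔ : 0 < Δ.im) :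
    IsQuasiPeriodic (unitPeriods Δ hΔ) (fun _ => -1) (thetaMultiplier Δ) (fun u => theta1 u Δ) :=
  ⟨fun u => theta1_add_one u Δ, fun u => theta1_add_period u Δ⟩

theorem theta1_eq_zero_of_mem_lattice {hΔ : 0 < Δ.im} {u : ℂ}
    (hu : u ∈ (unitPeriods Δ hΔ).lattice) : theta1 u Δ = 0 := by
  have htranslate := (isQuasiPeriodic_theta1 hΔ).eq_zero_add_iff
    (fun _ => neg_ne_zero.2 one_ne_zero) (thetaMultiplier_ne_zero Δ) hu 0
  rw [zero_add] at htranslate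
  exact htranslate.2 (theta1_zero Δ)

theorem exists_theta1_eq_const_mul_thetaProd (hΔ : 0 < Δ.im) :
    ∃ c ≠ 0, ∀ u, theta1 u Δ = c * thetaProd Δ u := by
  obtain ⟨c, hc⟩ := (isQuasiPeriodic_theta1 hΔ).exists_eq_const_mul (isQuasiPeriodic_thetaProd hΔ)
    (fun _ => neg_ne_zero.2 one_ne_zero) (thetaMultiplier_ne_zero Δ)
    (differentiable_theta1 hΔ) (differentiable_thetaProd hΔ)
    (fun _ hu => theta1_eq_zero_of_mem_lattice (mem_lattice_of_thetaProd_eq_zero hΔ hu))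
    (fun _ => deriv_thetaProd_ne_zero hΔ)
  refine ⟨c, ?_, hc⟩
  rintro rfl
  obtain ⟨u, hu⟩ := exists_theta1_ne_zero hΔ
  exact hu (by rw [hc, zero_mul])

theorem theta1_eq_zero_iff (hΔ : 0 < Δ.im) {u : ℂ} :
    theta1 u Δ = 0 ↔ u ∈ (unitPeriods Δ hΔ).lattice := by
  refine ⟨fun hu => ?_, theta1_eq_zero_of_mem_lattice⟩
  obtain ⟨c, hc, hprod⟩ := exists_theta1_eq_const_mul_thetaProd hΔ
  rw [hprod, mul_eq_zero, or_iff_right hc] at hu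
  exact mem_lattice_of_thetaProd_eq_zero hΔ hu

theorem hasDerivAt_theta1 (hΔ : 0 < Δ.im) (u : ℂ) :
    HasDerivAt (fun s => theta1 s Δ) (theta1' u Δ) u :=
  (differentiable_theta1 hΔ u).hasDerivAt

theorem theta1'_ne_zero (hΔ : 0 < Δ.im) {u : ℂ} (hu : theta1 u Δ = 0) : theta1' u Δ ≠ 0 := by
  obtain ⟨c, hc, hprod⟩ := exists_theta1_eq_const_mul_thetaProd hΔ
  rw [hprod, mul_eq_zero, or_iff_right hc] at hu
  rw [theta1', show (fun s => theta1 s Δ) = fun s => c * thetaProd Δ s from funext hprod,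
    deriv_const_mul _ (differentiable_thetaProd hΔ u)]
  exact mul_ne_zero hc (deriv_thetaProd_ne_zero hΔ hu)

theorem theta1'_neg (u Δ : ℂ) : theta1' (-u) Δ = theta1' u Δ := by
  have hodd := deriv_comp_neg (fun s => theta1 s Δ) u
  simp only [theta1_neg, deriv.fun_neg] at hodd
  exact (neg_inj.1 hodd).symm

theorem theta1'_add_one (u Δ : ℂ) : theta1' (u + 1) Δ = -1 * theta1' u Δ := by
  rw [theta1', ← deriv_comp_add_const]
  simp only [theta1_add_one, deriv_const_mul_field]
  rfl

theorem theta1'_add_period (hΔ : 0 < Δ.im) (u : ℂ) :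
    theta1' (u + Δ) Δ = thetaMultiplier Δ u * (theta1' u Δ - 2 * Real.pi * I * theta1 u Δ) := by
  have hproduct := (hasDerivAt_thetaMultiplier Δ u).fun_mul (hasDerivAt_theta1 hΔ u)
  rw [theta1', ← deriv_comp_add_const]
  simp only [theta1_add_period]
  rw [hproduct.deriv]
  ring

theorem differentiable_theta1' (hΔ : 0 < Δ.im) : Differentiable ℂ (fun u => theta1' u Δ) :=
  fun u => ((differentiable_theta1 hΔ).analyticAt u).deriv.differentiableAt

end Theta

section AdditionFormula

variable {Δ w : ℂ}

theorem isQuasiPeriodic_theta1_add_mul_theta1_add (hΔ : 0 < Δ.im) {a b : ℂ} (hab : a + b = w) :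
    IsQuasiPeriodic (unitPeriods Δ hΔ) (fun _ => 1)
      (fun u => thetaMultiplier Δ u * thetaMultiplier Δ (u + w))
      (fun u => theta1 (u + a) Δ * theta1 (u + b) Δ) where
  add_ω₁ u := by
    rw [unitPeriods_ω₁, add_right_comm u 1, add_right_comm u 1, theta1_add_one, theta1_add_one]
    ring
  add_ω₂ u := by
    rw [unitPeriods_ω₂, add_right_comm u Δ, add_right_comm u Δ, theta1_add_period,
      theta1_add_period, ← thetaMultiplier_mul_of_add_eq hab]
    ring

theorem deriv_theta1_mul_theta1_ne_zero (hΔ : 0 < Δ.im) (hw : theta1 w Δ ≠ 0) {u : ℂ}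
    (hu : theta1 u Δ * theta1 (u + w) Δ = 0) :
    deriv (fun u => theta1 u Δ * theta1 (u + w) Δ) u ≠ 0 := by
  rw [((hasDerivAt_theta1 hΔ u).fun_mul
    ((hasDerivAt_theta1 hΔ (u + w)).comp_add_const u w)).deriv]
  rcases mul_eq_zero.1 hu with hzero | hzero
  · have hother : theta1 (u + w) Δ ≠ 0 := fun h => hw <| by
      rw [theta1_eq_zero_iff hΔ] at hzero h ⊢
      simpa using sub_mem h hzero
    simpa [hzero] using mul_ne_zero (theta1'_ne_zero hΔ hzero) hother
  · have hother : theta1 u Δ ≠ 0 := fun h => hw <| by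
      rw [theta1_eq_zero_iff hΔ] at hzero h ⊢
      simpa using sub_mem hzero h
    simpa [hzero] using mul_ne_zero hother (theta1'_ne_zero hΔ hzero)

theorem exists_eq_const_mul_theta1_mul_theta1 (hΔ : 0 < Δ.im) (hw : theta1 w Δ ≠ 0) {D : ℂ → ℂ}
    (hD : Differentiable ℂ D) (hquasi : IsQuasiPeriodic (unitPeriods Δ hΔ) (fun _ => 1)
      (fun u => thetaMultiplier Δ u * thetaMultiplier Δ (u + w)) D)
    (hzero : D 0 = 0) (hneg : D (-w) = 0) :
    ∃ c, ∀ u, D u = c * (theta1 u Δ * theta1 (u + w) Δ) := by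
  have hne₂ : ∀ u, thetaMultiplier Δ u * thetaMultiplier Δ (u + w) ≠ 0 := fun u =>
    mul_ne_zero (thetaMultiplier_ne_zero Δ u) (thetaMultiplier_ne_zero Δ (u + w))
  have htheta := differentiable_theta1 hΔ
  have htarget := isQuasiPeriodic_theta1_add_mul_theta1_add hΔ (zero_add w)
  simp only [add_zero] at htarget
  refine hquasi.exists_eq_const_mul htarget (fun _ => one_ne_zero) hne₂ hD (by fun_prop)
    (fun u hu => ?_) (fun u => deriv_theta1_mul_theta1_ne_zero hΔ hw)
  rcases mul_eq_zero.1 hu with hmem | hmem <;> rw [theta1_eq_zero_iff hΔ] at hmem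
  · rwa [← zero_add u, hquasi.eq_zero_add_iff (fun _ => one_ne_zero) hne₂ hmem]
  · rwa [← neg_add_cancel_left w u, add_comm w u,
      hquasi.eq_zero_add_iff (fun _ => one_ne_zero) hne₂ hmem]

/-- The difference of the two sides of the addition formula `theta1_addition`, as a function
of `x`. -/
noncomputable def additionDefect (Δ y z x : ℂ) : ℂ :=
  theta1' x Δ * theta1 y Δ * theta1 z Δ * theta1 (x + (y + z)) Δ
    + theta1 x Δ * theta1' y Δ * theta1 z Δ * theta1 (x + (y + z)) Δ
    + theta1 x Δ * theta1 y Δ * theta1' z Δ * theta1 (x + (y + z)) Δ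
    - theta1 x Δ * theta1 y Δ * theta1 z Δ * theta1' (x + (y + z)) Δ
    - theta1' 0 Δ * theta1 (x + y) Δ * theta1 (x + z) Δ * theta1 (y + z) Δ

theorem isQuasiPeriodic_additionDefect (hΔ : 0 < Δ.im) (y z : ℂ) :
    IsQuasiPeriodic (unitPeriods Δ hΔ) (fun _ => 1)
      (fun u => thetaMultiplier Δ u * thetaMultiplier Δ (u + (y + z)))
      (additionDefect Δ y z) where
  add_ω₁ x := by
    simp only [unitPeriods_ω₁, additionDefect, add_right_comm x 1, theta1_add_one, theta1'_add_one]
    ring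
  add_ω₂ x := by
    simp only [unitPeriods_ω₂, additionDefect, add_right_comm x Δ, theta1_add_period,
      theta1'_add_period hΔ]
    linear_combination (-theta1' 0 Δ * theta1 (x + y) Δ * theta1 (x + z) Δ * theta1 (y + z) Δ) *
      thetaMultiplier_mul_of_add_eq (rfl : y + z = y + z) x

theorem additionDefect_eq_zero_of_ne_zero (hΔ : 0 < Δ.im) {y z : ℂ} (hy : theta1 y Δ ≠ 0)
    (hz : theta1 z Δ ≠ 0) (hyz : theta1 (y + z) Δ ≠ 0) (x : ℂ) : additionDefect Δ y z x = 0 := by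
  have htheta := differentiable_theta1 hΔ
  have htheta' := differentiable_theta1' hΔ
  have hdiff : Differentiable ℂ (additionDefect Δ y z) := by
    unfold additionDefect
    fun_prop
  have hzero : additionDefect Δ y z 0 = 0 := by
    simp only [additionDefect, zero_add, theta1_zero]
    ring
  have hneg : additionDefect Δ y z (-(y + z)) = 0 := by
    have hy' : -(y + z) + y = -z := by ring
    have hz' : -(y + z) + z = -y := by ring
    simp only [additionDefect, neg_add_cancel, hy', hz', theta1_neg, theta1_zero]
    ring
  obtain ⟨c, hc⟩ := exists_eq_const_mul_theta1_mul_theta1 hΔ hyz hdiff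
    (isQuasiPeriodic_additionDefect hΔ y z) hzero hneg
  have hnegy : additionDefect Δ y z (-y) = 0 := by
    simp only [additionDefect, neg_add_cancel, neg_add_cancel_left, theta1_neg, theta1'_neg,
      theta1_zero]
    ring
  have hc_zero : c = 0 := by
    have hat := hc (-y)
    rw [hnegy, neg_add_cancel_left, theta1_neg, eq_comm, mul_eq_zero] at hat
    exact hat.resolve_right (mul_ne_zero (neg_ne_zero.2 hy) hz)
  rw [hc, hc_zero, zero_mul]

theorem dense_setOf_theta1_ne_zero (hΔ : 0 < Δ.im) (b : ℂ) :
    Dense {u | theta1 u Δ ≠ 0 ∧ theta1 (u + b) Δ ≠ 0} := by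
  have hcountable := countable_lattice (unitPeriods Δ hΔ)
  convert (hcountable.union (hcountable.preimage (add_left_injective b))).dense_compl ℝ
  simp only [Ne, theta1_eq_zero_iff hΔ, ← not_or]
  rfl

theorem theta1_addition (hΔ : 0 < Δ.im) (x y z : ℂ) :
    theta1' x Δ * theta1 y Δ * theta1 z Δ * theta1 (x + (y + z)) Δ
      + theta1 x Δ * theta1' y Δ * theta1 z Δ * theta1 (x + (y + z)) Δ
      + theta1 x Δ * theta1 y Δ * theta1' z Δ * theta1 (x + (y + z)) Δ
      - theta1 x Δ * theta1 y Δ * theta1 z Δ * theta1' (x + (y + z)) Δ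
      = theta1' 0 Δ * theta1 (x + y) Δ * theta1 (x + z) Δ * theta1 (y + z) Δ := by
  have htheta := differentiable_theta1 hΔ
  have htheta' := differentiable_theta1' hΔ
  have hcont_y : ∀ z, Continuous fun y => additionDefect Δ y z x := fun z => by
    unfold additionDefect
    exact Differentiable.continuous (𝕜 := ℂ) (by fun_prop)
  have hcont_z : Continuous fun z => additionDefect Δ y z x := by
    unfold additionDefect
    exact Differentiable.continuous (𝕜 := ℂ) (by fun_prop)
  have hgeneric : ∀ z, theta1 z Δ ≠ 0 → additionDefect Δ y z x = 0 := fun z hz =>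
    congrFun ((hcont_y z).ext_on (dense_setOf_theta1_ne_zero hΔ z) continuous_const
      fun y hy => additionDefect_eq_zero_of_ne_zero hΔ hy.1 hz hy.2 x) y
  exact sub_eq_zero.1 <| congrFun (hcont_z.ext_on
    ((dense_setOf_theta1_ne_zero hΔ 0).mono fun _ => And.left) continuous_const hgeneric) z

end AdditionFormula

section Tau

variable {γ δ ε Δ : ℂ} {k : ℤ}

theorem tau_add (x c t : ℂ) : tau γ δ ε Δ k (x + c) t
    = theta1 (k * x + omega γ δ ε Δ k * t + k * c) Δ := by
  rw [tau, mul_add, add_right_comm]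

theorem hasDerivAt_tau (hΔ : 0 < Δ.im) (x t : ℂ) :
    HasDerivAt (tau γ δ ε Δ k x)
      (omega γ δ ε Δ k * theta1' (k * x + omega γ δ ε Δ k * t) Δ) t := by
  have hphase : HasDerivAt (fun t : ℂ => (k : ℂ) * x + omega γ δ ε Δ k * t)
      (omega γ δ ε Δ k) t := by
    simpa using ((hasDerivAt_id t).const_mul (omega γ δ ε Δ k)).const_add ((k : ℂ) * x)
  exact ((hasDerivAt_theta1 hΔ _).comp t hphase).congr_deriv (mul_comm _ _)

theorem differentiable_tau (hΔ : 0 < Δ.im) (t : ℂ) :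
    Differentiable ℂ fun z => tau γ δ ε Δ k z t :=
  (differentiable_theta1 hΔ).fun_comp (by fun_prop)

theorem isBilinearSolution_tau (hΔ : 0 < Δ.im) (hkγ : theta1 (k * γ) Δ ≠ 0)
    (hkδ : theta1 (k * δ) Δ ≠ 0) (hkδγ : theta1 (k * (δ - γ)) Δ ≠ 0) :
    IsBilinearSolution γ δ ε (etaZero γ δ ε Δ k) (tau γ δ ε Δ k) := by
  refine ⟨fun x t => (hasDerivAt_tau hΔ x t).differentiableAt, fun x t => ?_⟩
  have hderiv_zero : theta1' 0 Δ ≠ 0 := theta1'_ne_zero hΔ (theta1_zero Δ)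
  have hsum : (k : ℂ) * γ + k * (δ - γ) = k * δ := by ring
  have haddition := theta1_addition hΔ (k * x + omega γ δ ε Δ k * t) (k * γ) (k * (δ - γ))
  have hneg : (k : ℂ) * (γ - δ) = -(k * (δ - γ)) := by ring
  rw [hirotaD, (hasDerivAt_tau hΔ _ _).deriv, (hasDerivAt_tau hΔ _ _).deriv, add_sub_assoc,
    tau_add, tau_add, tau_add, mul_add (k : ℂ) x δ, add_right_comm _ (k * δ), etaZero, hneg,
    theta1_neg, theta1'_neg]
  rw [hsum] at haddition
  simp only [tau]
  generalize (k : ℂ) * x + omega γ δ ε Δ k * t = u at *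
  rw [omega]
  field_simp
  linear_combination ε * haddition

theorem eta_eq (z t : ℂ) : eta γ δ ε Δ k z t =
    ε * (fun u => theta1 (u + k * (δ - γ)) Δ * theta1 (u + k * γ) Δ /
      (theta1 (u + k * δ) Δ * theta1 (u + 0) Δ)) (k * z + omega γ δ ε Δ k * t) := by
  rw [eta, add_sub_assoc, tau_add, tau_add, tau_add, tau]
  simp only [add_zero]

theorem eta_periodic (hΔ : 0 < Δ.im) (hk : k ≠ 0) (t : ℂ) :
    Function.Periodic (fun z => eta γ δ ε Δ k z t) 1 ∧
      Function.Periodic (fun z => eta γ δ ε Δ k z t) (Δ / k) := by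
  have hkℂ : (k : ℂ) ≠ 0 := Int.cast_ne_zero.2 hk
  obtain ⟨hone, hΔ_period⟩ := IsQuasiPeriodic.div_periodic
    (isQuasiPeriodic_theta1_add_mul_theta1_add hΔ (show k * (δ - γ) + k * γ = k * δ by ring))
    (isQuasiPeriodic_theta1_add_mul_theta1_add hΔ (add_zero (k * δ)))
    (fun _ => one_ne_zero)
    (fun u => mul_ne_zero (thetaMultiplier_ne_zero Δ u) (thetaMultiplier_ne_zero Δ _))
  rw [unitPeriods_ω₁] at hone
  rw [unitPeriods_ω₂] at hΔ_period
  have hphase_one : ∀ z, (k : ℂ) * (z + 1) + omega γ δ ε Δ k * t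
      = k * z + omega γ δ ε Δ k * t + k * 1 := fun z => by ring
  have hphase_Δ : ∀ z, (k : ℂ) * (z + Δ / k) + omega γ δ ε Δ k * t
      = k * z + omega γ δ ε Δ k * t + Δ := fun z => by field_simp; ring
  constructor <;> intro z <;> dsimp only <;> rw [eta_eq, eta_eq]
  · rw [hphase_one, hone.int_mul k]
  · rw [hphase_Δ, hΔ_period]

theorem meromorphic_eta (hΔ : 0 < Δ.im) (t : ℂ) : Meromorphic fun z => eta γ δ ε Δ k z t := by
  intro z
  have htau : ∀ c, MeromorphicAt (fun z => tau γ δ ε Δ k (z + c) t) z := fun c =>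
    (((differentiable_tau hΔ t).comp (differentiable_id.add_const c)).analyticAt z).meromorphicAt
  have htau_zero := htau 0
  simp only [add_zero] at htau_zero
  unfold eta
  simp only [add_sub_assoc]
  exact (MeromorphicAt.const ε z).fun_mul
    (((htau (δ - γ)).fun_mul (htau γ)).fun_div ((htau δ).fun_mul htau_zero))

theorem tau_add_int_eq_zero_iff (hΔ : 0 < Δ.im) (z t : ℂ) (n : ℤ) :
    tau γ δ ε Δ k (z + n) t = 0 ↔ tau γ δ ε Δ k z t = 0 := by
  have hmem := intCast_mem_lattice (hδ := hΔ) (k * n)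
  push_cast at hmem
  rw [tau_add, theta1_eq_zero_iff hΔ, tau, theta1_eq_zero_iff hΔ,
    (unitPeriods Δ hΔ).lattice.add_mem_iff_left hmem]

theorem isOpen_regularTimes (hΔ : 0 < Δ.im) : IsOpen (regularTimes δ (tau γ δ ε Δ k)) := by
  refine isOpen_iff_mem_nhds.2 fun t₀ ht₀ => ?_
  have hcont : Continuous fun p : ℂ × ℂ => tau γ δ ε Δ k p.2 p.1 :=
    (differentiable_theta1 hΔ).continuous.comp (by fun_prop)
  have hcell : ∀ᶠ t in 𝓝 t₀, ∀ z ∈ Set.Icc (0 : ℝ) 1 ×ℂ Set.Icc (0 : ℝ) δ.im,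
      tau γ δ ε Δ k z t ≠ 0 :=
    (isCompact_Icc.reProdIm isCompact_Icc).eventually_forall_of_forall_eventually
      fun z hz => hcont.continuousAt.eventually_ne (ht₀ z hz.2.1 hz.2.2)
  filter_upwards [hcell] with t ht z hz_nonneg hz_le hzero
  refine ht (z + (-⌊z.re⌋ : ℤ)) ⟨⟨?_, ?_⟩, ?_⟩ ((tau_add_int_eq_zero_iff hΔ z t _).2 hzero)
  · simp [Int.floor_le]
  · simp [(Int.lt_floor_add_one z.re).le, add_comm]
  · simp [hz_nonneg, hz_le]

theorem regularTimes_nonempty (hΔ : 0 < Δ.im) (hω : omega γ δ ε Δ k ≠ 0)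
    (hkδ : |(k : ℝ)| * δ.im < Δ.im) : (regularTimes δ (tau γ δ ε Δ k)).Nonempty := by
  -- At this time the strip is mapped into one symmetric about the line `Im u = Im Δ / 2`.
  refine ⟨((Δ.im - k * δ.im) / 2 : ℝ) * I / omega γ δ ε Δ k, fun z hz_nonneg hz_le hzero => ?_⟩
  rw [tau, mul_div_cancel₀ _ hω, theta1_eq_zero_iff hΔ] at hzero
  have him : (k * z + ((Δ.im - k * δ.im) / 2 : ℝ) * I).im - Δ.im / 2
      = k * (z.im - δ.im / 2) := by
    rw [add_im, im_ofReal_mul, I_im, ← ofReal_intCast, im_ofReal_mul]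
    ring
  have hdist : |(k : ℝ) * (z.im - δ.im / 2)| < Δ.im / 2 := by
    rw [abs_mul]
    have hmid : |z.im - δ.im / 2| ≤ δ.im / 2 := abs_le.2 ⟨by linarith, by linarith⟩
    linarith [mul_le_mul_of_nonneg_left hmid (abs_nonneg (k : ℝ))]
  rw [← him, abs_lt] at hdist
  exact notMem_lattice_of_im (by linarith [hdist.1]) (by linarith [hdist.2]) hzero

end Tau

/-! ### The zeta function -/

section Zeta

/-- The summand, for the period `l`, of the Weierstrass zeta function without its term `1 / z`. -/
noncomputable def zetaTerm (l z : ℂ) : ℂ := if l = 0 then 0 else 1 / (z - l) + 1 / l + z / l ^ 2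

theorem norm_zetaTerm_le {r : ℝ} {z l : ℂ} (hr : 0 < r) (hz : ‖z‖ < r) (hl : 2 * r ≤ ‖l‖) :
    ‖zetaTerm l z‖ ≤ 2 * r ^ 2 * ‖l‖ ^ (-3 : ℝ) := by
  have hl_pos : 0 < ‖l‖ := by linarith
  have hl_ne : l ≠ 0 := norm_pos_iff.1 hl_pos
  have hdist : ‖l‖ / 2 ≤ ‖z - l‖ := by
    rw [norm_sub_rev]
    exact le_trans (by linarith) (norm_sub_norm_le l z)
  have hzl : z - l ≠ 0 := norm_pos_iff.1 (by linarith)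
  have hterm : zetaTerm l z = z ^ 2 / ((z - l) * l ^ 2) := by
    rw [zetaTerm, if_neg hl_ne]
    field_simp
    ring
  have hcube : ‖l‖ ^ (-3 : ℝ) = 1 / ‖l‖ ^ 3 := by
    rw [Real.rpow_neg hl_pos.le, one_div]
    norm_cast
  rw [hterm, norm_div, norm_mul, norm_pow, norm_pow, hcube]
  calc ‖z‖ ^ 2 / (‖z - l‖ * ‖l‖ ^ 2) ≤ r ^ 2 / (‖l‖ / 2 * ‖l‖ ^ 2) := by gcongr
    _ = 2 * r ^ 2 * (1 / ‖l‖ ^ 3) := by field_simp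

theorem hasDerivAt_zetaTerm {l z : ℂ} (hz : l = 0 ∨ z ≠ l) :
    HasDerivAt (zetaTerm l) (-(if l = 0 then 0 else 1 / (z - l) ^ 2 - 1 / l ^ 2)) z := by
  rcases eq_or_ne l 0 with rfl | hl
  · rw [if_pos rfl, neg_zero]
    exact (hasDerivAt_const z (0 : ℂ)).congr_of_eventuallyEq (.of_forall fun _ => if_pos rfl)
  · have hzl : z - l ≠ 0 := sub_ne_zero.2 (hz.resolve_left hl)
    have hsum := ((((hasDerivAt_id z).sub_const l).inv hzl).add_const (1 / l)).add
      ((hasDerivAt_id z).div_const (l ^ 2))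
    rw [if_neg hl]
    refine (hsum.congr_of_eventuallyEq (.of_forall fun _ => ?_)).congr_deriv ?_
    · simp [zetaTerm, hl]
    · simp only [id]
      ring

theorem zetaTerm_neg (l z : ℂ) : zetaTerm (-l) (-z) = -zetaTerm l z := by
  have hsub : -z - -l = -(z - l) := by ring
  simp only [zetaTerm, neg_eq_zero, hsub]
  split_ifs
  · rw [neg_zero]
  · rw [neg_sq, div_neg, div_neg, neg_div]
    ring

theorem zetaTerm_mul_mul {a : ℂ} (ha : a ≠ 0) (l z : ℂ) :
    zetaTerm (a * l) (a * z) = 1 / a * zetaTerm l z := by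
  simp only [zetaTerm, mul_eq_zero, ha, false_or, ← mul_sub]
  split_ifs
  · rw [mul_zero]
  · field_simp

variable (L : PeriodPair)

/-- The Weierstrass zeta function of the lattice `L` without its term `1 / z`. -/
noncomputable def zetaExcept (z : ℂ) : ℂ := ∑' l : L.lattice, zetaTerm l z

/-- The Weierstrass zeta function of the lattice `L`. -/
noncomputable def latticeZeta (z : ℂ) : ℂ := 1 / z + zetaExcept L z

theorem hasSumLocallyUniformly_zetaTerm :
    HasSumLocallyUniformly (fun (l : L.lattice) z => zetaTerm l z) (zetaExcept L) := by
  refine L.hasSumLocallyUniformly_aux (u := fun r l => 2 * r ^ 2 * ‖l‖ ^ (-3 : ℝ)) _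
    (fun _ _ => (ZLattice.summable_norm_rpow _ _ (by simp; norm_num)).mul_left _) fun r hr =>
    Filter.eventually_atTop.mpr ⟨2 * r, ?_⟩
  rintro _ hradius z hz l rfl
  exact norm_zetaTerm_le hr hz hradius

theorem hasDerivAt_zetaExcept {z : ℂ} (hz : z ∈ ((L.lattice : Set ℂ) \ {0})ᶜ) :
    HasDerivAt (zetaExcept L) (-L.weierstrassPExcept 0 z) z := by
  have hterm : ∀ (l : L.lattice), ∀ z ∈ ((L.lattice : Set ℂ) \ {0})ᶜ,
      HasDerivAt (zetaTerm l) (-(if l.1 = 0 then 0 else 1 / (z - l) ^ 2 - 1 / l ^ 2)) z := by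
    refine fun l z hz => hasDerivAt_zetaTerm (or_iff_not_imp_left.2 ?_)
    rintro hl rfl
    exact hz ⟨l.2, hl⟩
  have hpartial : ∀ᶠ s : Finset L.lattice in atTop, DifferentiableOn ℂ
      (fun z => ∑ l ∈ s, zetaTerm l z) ((L.lattice : Set ℂ) \ {0})ᶜ :=
    .of_forall fun s => .fun_sum fun l _ z hz =>
      (hterm l z hz).differentiableAt.differentiableWithinAt
  have hlimit := hasSumLocallyUniformly_zetaTerm L
  have hderiv := ((hlimit.hasSumLocallyUniformlyOn.differentiableOn hpartial
    L.isOpen_compl_lattice_sdiff).differentiableAt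
      (L.isOpen_compl_lattice_sdiff.mem_nhds hz)).hasDerivAt
  have hderiv_tendsto := (hlimit.tendstoLocallyUniformlyOn.deriv hpartial
    L.isOpen_compl_lattice_sdiff).tendsto_at hz
  refine hderiv.congr_deriv (tendsto_nhds_unique hderiv_tendsto ?_)
  refine Tendsto.congr (fun s => ?_) (L.hasSum_weierstrassPExcept 0 z).neg
  exact (HasDerivAt.fun_sum fun l _ => hterm l z hz).deriv.symm

theorem zetaExcept_neg (z : ℂ) : zetaExcept L (-z) = -zetaExcept L z := by
  rw [zetaExcept, zetaExcept, ← (Equiv.neg L.lattice).tsum_eq, ← tsum_neg]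
  exact tsum_congr fun l => zetaTerm_neg l z

theorem latticeZeta_neg (z : ℂ) : latticeZeta L (-z) = -latticeZeta L z := by
  rw [latticeZeta, latticeZeta, zetaExcept_neg, div_neg, neg_add]

variable {L}

theorem hasDerivAt_latticeZeta {z : ℂ} (hz : z ∉ L.lattice) :
    HasDerivAt (latticeZeta L) (-L.weierstrassP z) z := by
  have hz_ne : z ≠ 0 := fun h => hz (h ▸ L.lattice.zero_mem)
  have hsum := (hasDerivAt_inv hz_ne).add (hasDerivAt_zetaExcept L (z := z) fun h => hz h.1)
  refine (hsum.congr_of_eventuallyEq (.of_forall fun _ => ?_)).congr_deriv ?_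
  · simp [latticeZeta]
  · have hexcept := L.weierstrassPExcept_add 0 z
    simp only [ZeroMemClass.coe_zero, sub_zero] at hexcept
    rw [← hexcept]
    ring

theorem analyticAt_latticeZeta {z : ℂ} (hz : z ∉ L.lattice) : AnalyticAt ℂ (latticeZeta L) z := by
  refine Complex.analyticAt_iff_eventually_differentiableAt.2 ?_
  filter_upwards [L.isClosed_lattice.isOpen_compl.mem_nhds hz] with w hw
  exact (hasDerivAt_latticeZeta hw).differentiableAt

theorem isPreconnected_compl_lattice : IsPreconnected (L.lattice : Set ℂ)ᶜ := by
  refine (Set.Countable.isPathConnected_compl_of_one_lt_rank ?_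
    (countable_lattice L)).isConnected.isPreconnected
  rw [rank_real_complex]
  norm_num

/-- The derivative of the zeta function is elliptic. -/
theorem exists_latticeZeta_add_eq {l : ℂ} (hl : l ∈ L.lattice) :
    ∃ c, ∀ z ∉ L.lattice, latticeZeta L (z + l) = latticeZeta L z + c := by
  have hderiv : ∀ z ∈ (L.lattice : Set ℂ)ᶜ,
      HasDerivAt (fun z => latticeZeta L (z + l) - latticeZeta L z) 0 z := by
    intro z hz
    have hzl : z + l ∉ L.lattice := fun h => hz ((L.lattice.add_mem_iff_left hl).1 h)
    have hdiff := ((hasDerivAt_latticeZeta hzl).comp_add_const z l).sub (hasDerivAt_latticeZeta hz)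
    have hperiod := L.weierstrassP_add_coe z ⟨l, hl⟩
    rw [hperiod, sub_self] at hdiff
    exact hdiff
  obtain ⟨c, hc⟩ := L.isClosed_lattice.isOpen_compl.exists_is_const_of_deriv_eq_zero
    isPreconnected_compl_lattice
    (fun z hz => (hderiv z hz).differentiableAt.differentiableWithinAt)
    (fun z hz => (hderiv z hz).deriv)
  exact ⟨c, fun z hz => by linear_combination hc z hz⟩

theorem eventually_notMem_lattice (z : ℂ) : ∀ᶠ y in 𝓝[≠] z, y ∉ L.lattice := by
  filter_upwards [nhdsWithin_le_nhds (L.compl_lattice_sdiff_singleton_mem_nhds z),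
    self_mem_nhdsWithin] with y hy hyz hmem using hy ⟨hmem, hyz⟩

theorem eventually_add_notMem_lattice (b z : ℂ) : ∀ᶠ y in 𝓝[≠] z, y + b ∉ L.lattice := by
  have hshift := eventually_notMem_lattice (L := L) (z + b)
  rwa [← map_add_right_nhdsNE, eventually_map] at hshift

theorem hasSimplePoleAt_latticeZeta {l : ℂ} (hl : l ∈ L.lattice) :
    HasSimplePoleAt (latticeZeta L) 1 l := by
  have hzero : HasSimplePoleAt (latticeZeta L) 1 0 := by
    refine ⟨zetaExcept L, Complex.analyticAt_iff_eventually_differentiableAt.2 ?_,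
      by simp [latticeZeta]⟩
    filter_upwards [L.compl_lattice_sdiff_singleton_mem_nhds 0] with w hw
    exact (hasDerivAt_zetaExcept L hw).differentiableAt
  obtain ⟨c, hc⟩ := exists_latticeZeta_add_eq (L.lattice.neg_mem hl)
  have hshift : HasSimplePoleAt (fun z => latticeZeta L (z + -l)) 1 l :=
    HasSimplePoleAt.comp_add_const (by rwa [add_neg_cancel])
  have hsub := hshift.sub (hasSimplePoleAt_zero_of_analyticAt (analyticAt_const (v := c)))
  rw [sub_zero] at hsub
  refine hsub.congr ?_
  filter_upwards [eventually_notMem_lattice l] with z hz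
  rw [hc z hz, add_sub_cancel_right]

theorem weierstrassZeta_two_mul {ω₁ ω₂ : ℂ} (hδ : 0 < (ω₂ / ω₁).im) (u : ℂ) :
    weierstrassZeta ω₁ ω₂ (2 * ω₁ * u)
      = 1 / (2 * ω₁) * latticeZeta (unitPeriods (ω₂ / ω₁) hδ) u := by
  have hω₁ : ω₁ ≠ 0 := by
    rintro rfl
    simp at hδ
  set L := unitPeriods (ω₂ / ω₁) hδ
  have hperiod : ∀ v : ℤ × ℤ, (2 * v.1 * ω₁ + 2 * v.2 * ω₂ : ℂ)
      = 2 * ω₁ * (L.latticeEquivProd.symm v : L.lattice) := by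
    intro v
    rw [L.latticeEquiv_symm_apply, unitPeriods_ω₁, unitPeriods_ω₂]
    field_simp
  have hterm : ∀ v : {v : ℤ × ℤ // v ≠ 0},
      1 / (2 * ω₁ * u - (2 * v.1.1 * ω₁ + 2 * v.1.2 * ω₂)) + 1 / (2 * v.1.1 * ω₁ + 2 * v.1.2 * ω₂)
        + 2 * ω₁ * u / (2 * v.1.1 * ω₁ + 2 * v.1.2 * ω₂) ^ 2
      = 1 / (2 * ω₁) * zetaTerm (L.latticeEquivProd.symm v.1 : L.lattice) u := by
    intro v
    have hv : 2 * ω₁ * ((L.latticeEquivProd.symm v.1 : L.lattice) : ℂ) ≠ 0 := by simp [hω₁, v.2]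
    rw [hperiod, ← zetaTerm_mul_mul (by simp [hω₁]), zetaTerm, if_neg hv]
  have hsum : ∑' v : {v : ℤ × ℤ // v ≠ 0}, zetaTerm (L.latticeEquivProd.symm v.1 : L.lattice) u
      = zetaExcept L u := by
    rw [zetaExcept, ← L.latticeEquivProd.symm.toEquiv.tsum_eq]
    refine tsum_subtype_eq_of_support_subset
      (f := fun v : ℤ × ℤ => zetaTerm (L.latticeEquivProd.symm v : L.lattice) u)
      (s := {v | v ≠ 0}) ?_
    rintro v hv rfl
    simp [zetaTerm] at hv
  rw [weierstrassZeta, tsum_congr hterm, tsum_mul_left, hsum, latticeZeta, mul_add,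
    one_div_mul_one_div]

end Zeta

section Kernel

variable {L : PeriodPair} {γ u : ℂ}

/-- The poles of the discrete Laplacian with step `γ` of the zeta function of `L`. -/
def laplacianPoles (L : PeriodPair) (γ : ℂ) : Set ℂ :=
  {u | u - γ ∈ L.lattice ∨ u ∈ L.lattice ∨ u + γ ∈ L.lattice}

theorem kernel_eq_discreteLaplacian {ω₁ ω₂ : ℂ} (hδ : 0 < (ω₂ / ω₁).im) (γ u : ℂ) :
    kernel ω₁ ω₂ γ u
      = 1 / (2 * ω₁) * discreteLaplacian γ (latticeZeta (unitPeriods (ω₂ / ω₁) hδ)) u := by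
  simp only [kernel, discreteLaplacian, weierstrassZeta_two_mul hδ]
  ring

theorem discreteLaplacian_neg {f : ℂ → ℂ} (hf : ∀ u, f (-u) = -f u) (γ u : ℂ) :
    discreteLaplacian γ f (-u) = -discreteLaplacian γ f u := by
  rw [discreteLaplacian, discreteLaplacian, ← neg_add', neg_add_eq_sub, ← neg_sub u γ, hf, hf, hf]
  ring

theorem discreteLaplacian_latticeZeta_add {l : ℂ} (hl : l ∈ L.lattice)
    (hu : u ∉ laplacianPoles L γ) :
    discreteLaplacian γ (latticeZeta L) (u + l) = discreteLaplacian γ (latticeZeta L) u := by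
  obtain ⟨c, hc⟩ := exists_latticeZeta_add_eq hl
  simp only [laplacianPoles, Set.mem_ofPred_eq, not_or] at hu
  obtain ⟨hu_sub, hu_mid, hu_add⟩ := hu
  rw [discreteLaplacian, discreteLaplacian, add_sub_right_comm, add_right_comm, hc _ hu_sub,
    hc _ hu_mid, hc _ hu_add]
  ring

theorem analyticAt_discreteLaplacian_latticeZeta (hu : u ∉ laplacianPoles L γ) :
    AnalyticAt ℂ (discreteLaplacian γ (latticeZeta L)) u := by
  simp only [laplacianPoles, Set.mem_ofPred_eq, not_or] at hu
  obtain ⟨hu_sub, hu_mid, hu_add⟩ := hu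
  exact (((analyticAt_latticeZeta hu_sub).fun_comp (f := fun u => u - γ) (by fun_prop)).sub
    (analyticAt_const.mul (analyticAt_latticeZeta hu_mid))).add
    ((analyticAt_latticeZeta hu_add).fun_comp (f := fun u => u + γ) (by fun_prop))

theorem add_mem_laplacianPoles_iff {l : ℂ} (hl : l ∈ L.lattice) :
    u + l ∈ laplacianPoles L γ ↔ u ∈ laplacianPoles L γ := by
  simp only [laplacianPoles, Set.mem_ofPred_eq, add_sub_right_comm, add_right_comm _ l γ,
    L.lattice.add_mem_iff_left hl]

theorem eventually_add_notMem_laplacianPoles (γ b z : ℂ) :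
    ∀ᶠ y in 𝓝[≠] z, y + b ∉ laplacianPoles L γ := by
  filter_upwards [eventually_add_notMem_lattice (b - γ) z, eventually_add_notMem_lattice b z,
    eventually_add_notMem_lattice (b + γ) z] with y hsub hmid hadd
  rw [laplacianPoles, Set.mem_ofPred_eq, add_sub_assoc, add_assoc]
  tauto

theorem ofReal_notMem_laplacianPoles {δ : ℂ} {hδ : 0 < δ.im} (hγ_pos : 0 < γ.im)
    (hγ_lt : γ.im < δ.im) {u : ℝ} (hu : ∀ n : ℤ, u ≠ n) :
    (u : ℂ) ∉ laplacianPoles (unitPeriods δ hδ) γ := by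
  rintro (hsub | hmid | hadd)
  · rw [← neg_mem_iff, neg_sub] at hsub
    exact notMem_lattice_of_im (by simpa) (by simpa) hsub
  · obtain ⟨n, hn⟩ := exists_eq_intCast_of_mem_lattice hmid (by simpa)
    exact hu n (by exact_mod_cast hn)
  · exact notMem_lattice_of_im (by simpa) (by simpa) hadd

end Kernel

/-! ### Principal values -/

section PrincipalValue

variable {x r y : ℝ} {f g : ℝ → ℂ} {v w : ℂ}

/-- The set of real numbers at distance at least `r` from `x + ℤ`. -/
def awayFromTranslates (x r : ℝ) : Set ℝ := {y | ∀ n : ℤ, r ≤ |y - (x + n)|}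

theorem isClosed_awayFromTranslates (x r : ℝ) : IsClosed (awayFromTranslates x r) := by
  rw [awayFromTranslates, Set.ofPred_forall]
  exact isClosed_iInter fun n => isClosed_le continuous_const (by fun_prop)

theorem ne_of_mem_awayFromTranslates (hr : 0 < r) (hy : y ∈ awayFromTranslates x r) (n : ℤ) :
    y ≠ x + n := by
  rintro rfl
  exact (hr.trans_le (hy n)).ne' (by rw [sub_self, abs_zero])

theorem add_one_mem_awayFromTranslates :
    y + 1 ∈ awayFromTranslates x r ↔ y ∈ awayFromTranslates x r := by
  refine (Equiv.addRight (-1 : ℤ)).forall_congr fun n => ?_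
  rw [Equiv.coe_addRight]
  push_cast
  rw [show y - (x + (n + -1)) = y + 1 - (x + n) by ring]

theorem two_mul_sub_mem_awayFromTranslates :
    2 * x - y ∈ awayFromTranslates x r ↔ y ∈ awayFromTranslates x r := by
  refine (Equiv.neg ℤ).forall_congr fun n => ?_
  rw [Equiv.neg_apply, ← abs_neg]
  push_cast
  rw [show y - (x + -n) = -(2 * x - y - (x + n)) by ring]

theorem truncatedPeriod_eq_inter (x r : ℝ) :
    truncatedPeriod x r = Set.Icc (-1 / 2) (1 / 2) ∩ awayFromTranslates x r := rfl

theorem isCompact_truncatedPeriod (x r : ℝ) : IsCompact (truncatedPeriod x r) :=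
  isCompact_Icc.inter_right (isClosed_awayFromTranslates x r)

theorem integral_truncatedPeriod (f : ℝ → ℂ) (x r : ℝ) :
    ∫ y in truncatedPeriod x r, f y
      = ∫ y in (-1 / 2 : ℝ)..(1 / 2), (awayFromTranslates x r).indicator f y := by
  rw [intervalIntegral.integral_of_le (by norm_num), ← integral_Icc_eq_integral_Ioc,
    setIntegral_indicator (isClosed_awayFromTranslates x r).measurableSet, truncatedPeriod_eq_inter]

theorem HasPrincipalValue.congr (hf : HasPrincipalValue x f v)
    (hgf : ∀ y : ℝ, (∀ n : ℤ, y ≠ x + n) → g y = f y) : HasPrincipalValue x g v := by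
  have hmeas : ∀ r, MeasurableSet (truncatedPeriod x r) := fun r =>
    (isCompact_truncatedPeriod x r).measurableSet
  have heqOn : ∀ r, 0 < r → Set.EqOn f g (truncatedPeriod x r) := fun r hr y hy =>
    (hgf y (ne_of_mem_awayFromTranslates hr hy.2)).symm
  refine ⟨fun r hr => (hf.1 r hr).congr_fun (heqOn r hr) (hmeas r), hf.2.congr' ?_⟩
  filter_upwards [self_mem_nhdsWithin] with r hr
  exact setIntegral_congr_fun (hmeas r) (heqOn r hr)

theorem HasPrincipalValue.add (hf : HasPrincipalValue x f v) (hg : HasPrincipalValue x g w) :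
    HasPrincipalValue x (fun y => f y + g y) (v + w) := by
  refine ⟨fun r hr => (hf.1 r hr).add (hg.1 r hr), (hf.2.add hg.2).congr' ?_⟩
  filter_upwards [self_mem_nhdsWithin] with r hr
  exact (integral_add (hf.1 r hr) (hg.1 r hr)).symm

theorem HasPrincipalValue.const_mul (hf : HasPrincipalValue x f v) (c : ℂ) :
    HasPrincipalValue x (fun y => c * f y) (c * v) :=
  ⟨fun r hr => (hf.1 r hr).const_mul c,
    (hf.2.const_mul c).congr fun _ => (integral_const_mul c _).symm⟩

theorem HasPrincipalValue.sub (hf : HasPrincipalValue x f v) (hg : HasPrincipalValue x g w) :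
    HasPrincipalValue x (fun y => f y - g y) (v - w) := by
  simpa only [sub_eq_add_neg, neg_one_mul] using hf.add (hg.const_mul (-1))

theorem hasPrincipalValue_zero (x : ℝ) : HasPrincipalValue x (fun _ => 0) 0 :=
  ⟨fun _ _ => integrableOn_zero, by simp⟩

theorem HasPrincipalValue.sum {ι : Type*} {s : Finset ι} {F : ι → ℝ → ℂ} {V : ι → ℂ}
    (hF : ∀ i ∈ s, HasPrincipalValue x (F i) (V i)) :
    HasPrincipalValue x (fun y => ∑ i ∈ s, F i y) (∑ i ∈ s, V i) := by
  classical
  induction s using Finset.induction_on with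
  | empty => simpa only [Finset.sum_empty] using hasPrincipalValue_zero x
  | insert i s hi ih =>
    simp only [Finset.sum_insert hi]
    exact (hF i (Finset.mem_insert_self i s)).add
      (ih fun j hj => hF j (Finset.mem_insert_of_mem hj))

theorem eventually_mem_awayFromTranslates (hy : ∀ n : ℤ, y ≠ x + n) :
    ∀ᶠ r in 𝓝[>] 0, y ∈ awayFromTranslates x r := by
  have hdist : 0 < |y - x - round (y - x)| := by
    rw [abs_pos, sub_sub]
    exact sub_ne_zero.2 (hy _)
  filter_upwards [Ioo_mem_nhdsGT hdist] with r hr n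
  rw [← sub_sub]
  exact hr.2.le.trans (round_le _ n)

theorem hasPrincipalValue_of_continuous (hf : Continuous f) (x : ℝ) :
    HasPrincipalValue x f (∫ y in (-1 / 2 : ℝ)..(1 / 2), f y) := by
  refine ⟨fun r _ => hf.continuousOn.integrableOn_compact (isCompact_truncatedPeriod x r), ?_⟩
  simp only [integral_truncatedPeriod]
  have hmeas : AEStronglyMeasurable f (volume.restrict (Set.uIoc (-1 / 2 : ℝ) (1 / 2))) :=
    hf.aestronglyMeasurable
  refine intervalIntegral.tendsto_integral_filter_of_dominated_convergence (fun y => ‖f y‖)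
    (.of_forall fun r => hmeas.indicator (isClosed_awayFromTranslates x r).measurableSet)
    (.of_forall fun r => .of_forall fun y _ => norm_indicator_le_norm_self f y)
    (hf.norm.intervalIntegrable _ _) ?_
  filter_upwards [(Set.countable_range fun n : ℤ => x + n).ae_notMem volume] with y hy _
  refine tendsto_const_nhds.congr' ?_
  filter_upwards [eventually_mem_awayFromTranslates fun n h => hy ⟨n, h.symm⟩] with r hr
  rw [Set.indicator_of_mem hr]

theorem integral_eq_zero_of_periodic_of_odd (hper : Function.Periodic f 1)
    (hodd : ∀ y, f (2 * x - y) = -f y) : ∫ y in (-1 / 2 : ℝ)..(1 / 2), f y = 0 := by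
  have hcenter : ∫ y in (-1 / 2 : ℝ)..(1 / 2), f y = ∫ y in (x - 1 / 2)..(x + 1 / 2), f y := by
    convert hper.intervalIntegral_add_eq (-1 / 2) (x - 1 / 2) using 2 <;> ring
  have hreflect : ∫ y in (x - 1 / 2)..(x + 1 / 2), f (2 * x - y)
      = ∫ y in (x - 1 / 2)..(x + 1 / 2), f y := by
    rw [intervalIntegral.integral_comp_sub_left f (2 * x)]
    congr 1 <;> ring
  simp only [hodd, intervalIntegral.integral_neg] at hreflect
  rw [hcenter]
  exact self_eq_neg.1 hreflect.symm

theorem hasPrincipalValue_of_odd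
    (hf : ∀ y : ℝ, (∀ n : ℤ, y ≠ x + n) → ContinuousAt f y)
    (hper : ∀ y : ℝ, (∀ n : ℤ, y ≠ x + n) → f (y + 1) = f y)
    (hodd : ∀ y : ℝ, (∀ n : ℤ, y ≠ x + n) → f (2 * x - y) = -f y) :
    HasPrincipalValue x f 0 := by
  refine ⟨fun r hr => ContinuousOn.integrableOn_compact (isCompact_truncatedPeriod x r)
    fun y hy => (hf y (ne_of_mem_awayFromTranslates hr hy.2)).continuousWithinAt, ?_⟩
  refine tendsto_const_nhds.congr' ?_
  filter_upwards [self_mem_nhdsWithin] with r hr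
  rw [integral_truncatedPeriod]
  refine (integral_eq_zero_of_periodic_of_odd (x := x) (fun y => ?_) fun y => ?_).symm <;>
    by_cases hy : y ∈ awayFromTranslates x r
  · rw [Set.indicator_of_mem (add_one_mem_awayFromTranslates.2 hy), Set.indicator_of_mem hy,
      hper y (ne_of_mem_awayFromTranslates hr hy)]
  · rw [Set.indicator_of_notMem (mt add_one_mem_awayFromTranslates.1 hy),
      Set.indicator_of_notMem hy]
  · rw [Set.indicator_of_mem (two_mul_sub_mem_awayFromTranslates.2 hy), Set.indicator_of_mem hy,
      hodd y (ne_of_mem_awayFromTranslates hr hy)]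
  · rw [Set.indicator_of_notMem (mt two_mul_sub_mem_awayFromTranslates.1 hy),
      Set.indicator_of_notMem hy, neg_zero]

end PrincipalValue

section Cotangent

variable {p z : ℂ}

/-- The function `π cot(πz)`: the function of period `1` with simple poles of residue `1` at the
integers that is bounded towards `±i∞`. -/
noncomputable def cotPi (z : ℂ) : ℂ := Real.pi * cot (Real.pi * z)

theorem cotPi_eq_div (z : ℂ) : cotPi z = Real.pi * cos (Real.pi * z) / sin (Real.pi * z) :=
  mul_div_assoc' _ _ _

theorem cotPi_neg (z : ℂ) : cotPi (-z) = -cotPi z := by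
  rw [cotPi_eq_div, cotPi_eq_div, mul_neg, cos_neg, sin_neg, div_neg]

theorem cotPi_periodic : Function.Periodic cotPi 1 := fun z => by
  rw [cotPi_eq_div, cotPi_eq_div, mul_add, mul_one, cos_add_pi, sin_add_pi, mul_neg, neg_div_neg_eq]

theorem cotPi_eq_expTwoPiI (z : ℂ) :
    cotPi z = Real.pi * ((expTwoPiI z + 1) / (I * (1 - expTwoPiI z))) := by
  rw [cotPi, cot_pi_eq_exp_ratio, expTwoPiI]

theorem sin_pi_mul_eq_zero_iff : sin (Real.pi * z) = 0 ↔ ∃ n : ℤ, z = n := by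
  rw [sin_eq_zero_iff]
  refine exists_congr fun n => ?_
  rw [mul_comm]
  exact mul_left_inj' (ofReal_ne_zero.2 Real.pi_ne_zero)

theorem analyticAt_cotPi (hz : ∀ n : ℤ, z ≠ n) : AnalyticAt ℂ cotPi z := by
  have hsin : sin (Real.pi * z) ≠ 0 := fun h => (sin_pi_mul_eq_zero_iff.1 h).elim hz
  simp only [funext cotPi_eq_div]
  fun_prop (disch := assumption)

theorem ne_intCast_of_im_ne_zero (hz : z.im ≠ 0) (n : ℤ) : z ≠ n := by
  rintro rfl
  exact hz (intCast_im n)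

theorem hasSimplePoleAt_cotPi (n : ℤ) : HasSimplePoleAt cotPi 1 n := by
  have hderiv : HasDerivAt (fun z : ℂ => sin (Real.pi * z)) (Real.pi * cos (Real.pi * n)) n := by
    simpa [mul_comm] using ((hasDerivAt_id (n : ℂ)).const_mul (Real.pi : ℂ)).csin
  have hsin : sin (Real.pi * n) = 0 := sin_pi_mul_eq_zero_iff.2 ⟨n, rfl⟩
  have hcos : cos (Real.pi * n) ≠ 0 := by
    intro h
    simpa [hsin, h] using sin_sq_add_cos_sq (Real.pi * (n : ℂ))
  have hderiv_ne : Real.pi * cos (Real.pi * n) ≠ 0 :=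
    mul_ne_zero (ofReal_ne_zero.2 Real.pi_ne_zero) hcos
  have hquot := HasSimplePoleAt.div_of_simple_zero (p := (n : ℂ))
    (f := fun z => Real.pi * cos (Real.pi * z))
    (g := fun z => sin (Real.pi * z)) (by fun_prop) (by fun_prop) hsin (by rwa [hderiv.deriv])
  rw [hderiv.deriv, div_self hderiv_ne] at hquot
  exact hquot.congr (.of_forall cotPi_eq_div)

/-- The mean value property on the circle `|e| = exp(2π Im p)` traced by `e = e^{2πi(y - p)}`. -/
theorem integral_comp_expTwoPiI_sub {G : ℂ → ℂ}
    (hG : DiffContOnCl ℂ G (Metric.ball 0 (Real.exp (2 * Real.pi * p.im)))) :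
    ∫ y in (-1 / 2 : ℝ)..(1 / 2), G (expTwoPiI (y - p)) = G 0 := by
  set R := Real.exp (2 * Real.pi * p.im) with hR
  have hcircle : ∀ y : ℝ, expTwoPiI (y - p)
      = circleMap 0 R (2 * Real.pi * y + Real.pi + (-Real.pi - 2 * Real.pi * p.re)) := by
    intro y
    rw [circleMap, zero_add, hR, ofReal_exp, ← exp_add, expTwoPiI]
    congr 1
    nth_rw 1 [← re_add_im p]
    push_cast
    linear_combination -(2 * Real.pi * p.im) * I_sq
  have haverage := Real.circleAverage_eq_integral_add (f := G) (c := 0) (R := R)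
    (-Real.pi - 2 * Real.pi * p.re)
  rw [DiffContOnCl.circleAverage (by rwa [abs_of_pos (Real.exp_pos _)])] at haverage
  simp only [hcircle]
  rw [haverage, intervalIntegral.integral_comp_mul_add
    (fun θ => G (circleMap 0 R (θ + (-Real.pi - 2 * Real.pi * p.re)))) Real.two_pi_pos.ne']
  congr 2 <;> ring

theorem integral_cotPi_sub_of_im_neg (hp : p.im < 0) :
    ∫ y in (-1 / 2 : ℝ)..(1 / 2), cotPi (y - p) = -(Real.pi * I) := by
  have hradius : Real.exp (2 * Real.pi * p.im) < 1 :=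
    Real.exp_lt_one_iff.2 (mul_neg_of_pos_of_neg Real.two_pi_pos hp)
  have hG : DiffContOnCl ℂ (fun e : ℂ => Real.pi * ((e + 1) / (I * (1 - e))))
      (Metric.ball 0 (Real.exp (2 * Real.pi * p.im))) := by
    refine DifferentiableOn.diffContOnCl_ball (U := Metric.ball 0 1) (fun e he => ?_)
      (Metric.closedBall_subset_ball hradius)
    have he_ne : I * (1 - e) ≠ 0 := by
      refine mul_ne_zero I_ne_zero (sub_ne_zero.2 ?_)
      rintro rfl
      simp at he
    fun_prop (disch := assumption)
  simp only [cotPi_eq_expTwoPiI]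
  rw [integral_comp_expTwoPiI_sub hG, zero_add, sub_zero, mul_one, one_div, inv_I, mul_neg]

theorem integral_cotPi_sub_of_im_pos (hp : 0 < p.im) :
    ∫ y in (-1 / 2 : ℝ)..(1 / 2), cotPi (y - p) = Real.pi * I := by
  have hreflect := intervalIntegral.integral_comp_neg (a := (-1 / 2 : ℝ)) (b := 1 / 2)
    (fun y : ℝ => cotPi (y - p))
  have hodd : ∀ y : ℝ, cotPi ((-y : ℝ) - p) = -cotPi (y - -p) := by
    intro y
    rw [← cotPi_neg]
    push_cast
    ring_nf
  simp only [hodd] at hreflect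
  rw [intervalIntegral.integral_neg, integral_cotPi_sub_of_im_neg (by simpa using hp), neg_neg,
    neg_div, neg_neg] at hreflect
  rw [neg_div, hreflect]

theorem ofReal_sub_ne_intCast {x y : ℝ} (hp : p.im = 0 → p = x) (hy : ∀ n : ℤ, y ≠ x + n) (n : ℤ) :
    (y : ℂ) - p ≠ n := by
  rcases eq_or_ne p.im 0 with him | him
  · rw [hp him, Ne, sub_eq_iff_eq_add']
    exact_mod_cast hy n
  · exact ne_intCast_of_im_ne_zero (by simpa using him) n

theorem continuousAt_cotPi_sub (hz : ∀ n : ℤ, z - p ≠ n) :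
    ContinuousAt (fun z => cotPi (z - p)) z :=
  ContinuousAt.comp' (g := cotPi) (f := fun z => z - p) (analyticAt_cotPi hz).continuousAt
    (by fun_prop)

theorem hasPrincipalValue_cotPi_sub {x : ℝ} (hp : p.im = 0 → p = x) :
    HasPrincipalValue x (fun y => cotPi (y - p)) (Real.pi * I * Real.sign p.im) := by
  have hcontinuousAt : ∀ y : ℝ, (∀ n : ℤ, (y : ℂ) - p ≠ n) →
      ContinuousAt (fun y : ℝ => cotPi (y - p)) y := fun y hy =>
    ContinuousAt.comp' (g := fun z => cotPi (z - p)) (f := ofReal) (continuousAt_cotPi_sub hy)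
      (by fun_prop)
  have hcontinuous : p.im ≠ 0 → Continuous fun y : ℝ => cotPi (y - p) := fun him =>
    continuous_iff_continuousAt.2 fun y =>
      hcontinuousAt y (ne_intCast_of_im_ne_zero (by simpa using him))
  rcases lt_trichotomy p.im 0 with him | him | him
  · convert hasPrincipalValue_of_continuous (hcontinuous him.ne) x using 1
    rw [integral_cotPi_sub_of_im_neg him, Real.sign_of_neg him, ofReal_neg, ofReal_one, mul_neg_one]
  · rw [him, Real.sign_zero, ofReal_zero, mul_zero]
    refine hasPrincipalValue_of_odd
      (fun y hy => hcontinuousAt y (ofReal_sub_ne_intCast hp hy)) (fun y _ => ?_) fun y _ => ?_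
    · rw [← cotPi_periodic ((y : ℂ) - p)]
      push_cast
      ring_nf
    · rw [← cotPi_neg, hp him]
      push_cast
      ring_nf
  · convert hasPrincipalValue_of_continuous (hcontinuous him.ne') x using 1
    rw [integral_cotPi_sub_of_im_pos him, Real.sign_of_pos him, ofReal_one, mul_one]

end Cotangent

section StripResidue

variable {T : ℂ} {F H : ℂ → ℂ} {x : ℝ}

theorem integral_add_of_periodic (hT : 0 ≤ T.im)
    (hH : ∀ z : ℂ, 0 ≤ z.im → z.im ≤ T.im → DifferentiableAt ℂ H z)
    (hper : Function.Periodic H 1) :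
    ∫ y in (-1 / 2 : ℝ)..(1 / 2), H (y + T) = ∫ y in (-1 / 2 : ℝ)..(1 / 2), H y := by
  have hrectangle := Complex.integral_boundary_rect_eq_zero_of_differentiableOn H
    ((-1 / 2 : ℝ) : ℂ) (((1 / 2 : ℝ) : ℂ) + T.im * I) fun z hz => by
      have him : z.im ∈ Set.Icc 0 T.im := by
        simpa [Set.uIcc_of_le hT] using hz.2
      exact (hH z him.1 him.2).differentiableWithinAt
  simp only [ofReal_re, ofReal_im, add_re, add_im, mul_re, mul_im, I_re, I_im, mul_zero, mul_one,
    zero_mul, sub_zero, add_zero, zero_add, ofReal_zero] at hrectangle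
  have hsides : ∀ y : ℝ, H (((1 / 2 : ℝ) : ℂ) + y * I) = H (((-1 / 2 : ℝ) : ℂ) + y * I) := by
    intro y
    rw [← hper (((-1 / 2 : ℝ) : ℂ) + y * I)]
    push_cast
    ring_nf
  have hvertical : ∫ y in (-1 / 2 : ℝ)..(1 / 2), H (y + T.im * I)
      = ∫ y in (-1 / 2 : ℝ)..(1 / 2), H y := by
    simp only [hsides] at hrectangle
    linear_combination -hrectangle
  have htop_periodic : Function.Periodic (fun y : ℝ => H (y + T.im * I)) 1 := by
    intro y
    dsimp only
    rw [← hper ((y : ℂ) + T.im * I), ofReal_add, ofReal_one, add_right_comm]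
  have hsplit : ∀ y : ℝ, (y : ℂ) + T = (y + T.re : ℝ) + T.im * I := by
    intro y
    rw [ofReal_add, add_assoc, re_add_im]
  simp only [hsplit]
  rw [← hvertical, intervalIntegral.integral_comp_add_right
    (fun y : ℝ => H (y + T.im * I)) T.re]
  convert htop_periodic.intervalIntegral_add_eq (-1 / 2 + T.re) (-1 / 2) using 2 <;> ring

theorem hasPrincipalValue_sub_add_of_periodic (hT : 0 ≤ T.im)
    (hH : ∀ z : ℂ, 0 ≤ z.im → z.im ≤ T.im → DifferentiableAt ℂ H z)
    (hper : Function.Periodic H 1) (x : ℝ) :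
    HasPrincipalValue x (fun y => H y - H (y + T)) 0 := by
  have hcont : ∀ c : ℂ, 0 ≤ c.im → c.im ≤ T.im → Continuous fun y : ℝ => H (y + c) :=
    fun c hc_nonneg hc_le => continuous_iff_continuousAt.2 fun y =>
      ContinuousAt.comp' (g := H) (f := fun y : ℝ => (y : ℂ) + c)
        (hH _ (by simpa using hc_nonneg) (by simpa using hc_le)).continuousAt (by fun_prop)
  have hbottom := hcont 0 le_rfl hT
  simp only [add_zero] at hbottom
  have hpv := (hasPrincipalValue_of_continuous hbottom x).sub
    (hasPrincipalValue_of_continuous (hcont T hT le_rfl) x)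
  rwa [integral_add_of_periodic hT hH hper, sub_self] at hpv

theorem hasPrincipalValue_cotPi_sub_add {p : ℂ} (hbot : p.im = 0 → p = x)
    (htop : p.im = T.im → p = x + T) :
    HasPrincipalValue x (fun y => cotPi (y - p) - cotPi (y + T - p))
      (Real.pi * I * (Real.sign p.im + Real.sign (T.im - p.im))) := by
  have hshifted : HasPrincipalValue x (fun y => cotPi (y - (p - T)))
      (Real.pi * I * Real.sign (p - T).im) :=
    hasPrincipalValue_cotPi_sub fun h => by
      rw [htop (sub_eq_zero.1 (by rwa [sub_im] at h)), add_sub_cancel_right]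
  convert (hasPrincipalValue_cotPi_sub hbot).sub hshifted using 1
  · funext y
    rw [sub_sub_eq_add_sub, add_sub_right_comm, sub_add_eq_add_sub]
  · rw [sub_im, ← neg_sub T.im, Real.sign_neg, ofReal_neg]
    ring

/-- The residue theorem for the strip between `ℝ` and `ℝ + T` modulo `1`. The poles on the two
boundary lines count half. -/
theorem hasPrincipalValue_sub_add_of_simplePoles {ι : Type*} [Fintype ι] {c p : ι → ℂ}
    (hT : 0 ≤ T.im) (hper : ∀ z, ∀ᶠ y in 𝓝[≠] z, F (y + 1) = F y)
    (hpoles : ∀ z : ℂ, 0 ≤ z.im → z.im ≤ T.im →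
      HasSimplePoleAt (fun z => F z - ∑ j, c j * cotPi (z - p j)) 0 z)
    (hcont : ∀ y : ℝ, (∀ n : ℤ, y ≠ x + n) → ContinuousAt F y ∧ ContinuousAt F (y + T))
    (hbot : ∀ j, (p j).im = 0 → p j = x) (htop : ∀ j, (p j).im = T.im → p j = x + T) :
    HasPrincipalValue x (fun y => F y - F (y + T))
      (Real.pi * I * ∑ j, c j * (Real.sign (p j).im + Real.sign (T.im - (p j).im))) := by
  set G : ℂ → ℂ := fun z => F z - ∑ j, c j * cotPi (z - p j) with hG
  have hG_periodic : Function.Periodic (regularize G) 1 := fun z => by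
    refine regularize_add_of_eventuallyEq ?_
    filter_upwards [hper z] with y hy
    simp only [hG, hy, add_sub_right_comm y 1, cotPi_periodic _]
  have hG_cont : ∀ z, ContinuousAt F z → (∀ j, ∀ n : ℤ, z - p j ≠ n) → ContinuousAt G z :=
    fun z hF hz => hF.sub (tendsto_finsetSum _ fun j _ =>
      (continuousAt_cotPi_sub (hz j)).const_mul (c j))
  have hregular := hasPrincipalValue_sub_add_of_periodic hT
    (fun z hz_nonneg hz_le => (hpoles z hz_nonneg hz_le).analyticAt_regularize.differentiableAt)
    hG_periodic x
  have hcot := HasPrincipalValue.sum (s := Finset.univ) fun j _ =>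
    (hasPrincipalValue_cotPi_sub_add (hbot j) (htop j)).const_mul (c j)
  convert (hregular.add hcot).congr fun y hy => ?_ using 1
  · rw [zero_add, Finset.mul_sum]
    exact Finset.sum_congr rfl fun j _ => by ring
  · have hbottom := hG_cont y (hcont y hy).1 fun j => ofReal_sub_ne_intCast (hbot j) hy
    have htop_line := hG_cont (y + T) (hcont y hy).2 fun j n => by
      rw [← sub_sub_eq_add_sub]
      refine ofReal_sub_ne_intCast (x := x) (fun h => ?_) hy n
      rw [htop j (sub_eq_zero.1 (by rwa [sub_im] at h)), add_sub_cancel_right]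
    rw [regularize_eq_self hbottom, regularize_eq_self htop_line]
    simp only [hG, mul_sub, Finset.sum_sub_distrib]
    ring

end StripResidue

section Transform

variable {δ γ : ℂ} {hδ : 0 < δ.im} {w : ℂ → ℂ} {x : ℝ}

theorem hasSimplePoleAt_latticeZeta_mul_sub_cotPi {a l z : ℂ} (hw : AnalyticAt ℂ w z)
    (hper : Function.Periodic w 1) (him : |(z - a).im| < δ.im)
    (hl : l ∈ (unitPeriods δ hδ).lattice) :
    HasSimplePoleAt (fun z => latticeZeta (unitPeriods δ hδ) (z - a + l) * w z
      - w a * cotPi (z - a)) 0 z := by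
  by_cases hz : ∃ n : ℤ, z - a = n
  · obtain ⟨n, hn⟩ := hz
    have hw_eq : w z = w a := by
      rw [eq_add_of_sub_eq' hn, ← mul_one (n : ℂ), hper.int_mul n]
    have hzeta : HasSimplePoleAt (fun z => latticeZeta (unitPeriods δ hδ) (z + (-a + l))) 1 z := by
      refine HasSimplePoleAt.comp_add_const ?_
      rw [← add_assoc, ← sub_eq_add_neg, hn]
      exact hasSimplePoleAt_latticeZeta (add_mem (intCast_mem_lattice n) hl)
    have hcot : HasSimplePoleAt (fun z => cotPi (z + -a)) 1 z := by
      refine HasSimplePoleAt.comp_add_const ?_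
      rw [← sub_eq_add_neg, hn]
      exact hasSimplePoleAt_cotPi n
    have hdiff := (hzeta.mul_analyticAt hw).sub (hcot.const_mul (w a))
    rw [hw_eq, one_mul, mul_one, sub_self] at hdiff
    simpa only [← add_assoc, ← sub_eq_add_neg] using hdiff
  · have hz_notMem : z - a + l ∉ (unitPeriods δ hδ).lattice := fun h =>
      hz (exists_eq_intCast_of_mem_lattice ((add_mem_cancel_right hl).1 h) him)
    have hzeta : AnalyticAt ℂ (fun z => latticeZeta (unitPeriods δ hδ) (z - a + l)) z :=
      (analyticAt_latticeZeta hz_notMem).fun_comp (f := fun z => z - a + l) (by fun_prop)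
    have hcot : AnalyticAt ℂ (fun z => cotPi (z - a)) z :=
      (analyticAt_cotPi (not_exists.1 hz)).fun_comp (f := fun z => z - a) (by fun_prop)
    exact hasSimplePoleAt_zero_of_analyticAt (by fun_prop)

theorem hasSimplePoleAt_const_mul_cotPi_sub {a z : ℂ} (c : ℂ) (him : (z - a).im ≠ 0) :
    HasSimplePoleAt (fun z => c * cotPi (z - a)) 0 z :=
  hasSimplePoleAt_zero_of_analyticAt (analyticAt_const.mul
    ((analyticAt_cotPi (ne_intCast_of_im_ne_zero him)).fun_comp (f := fun z => z - a)
      (by fun_prop)))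

theorem hasSimplePoleAt_latticeZeta_mul_sub_boundary_cotPi {z : ℂ} (hw : AnalyticAt ℂ w z)
    (hper : Function.Periodic w 1) (hz_nonneg : 0 ≤ z.im) (hz_le : z.im ≤ δ.im) :
    HasSimplePoleAt (fun z => latticeZeta (unitPeriods δ hδ) (z - x) * w z
      - w x * cotPi (z - x) - w (x + δ) * cotPi (z - (x + δ))) 0 z := by
  rcases hz_le.lt_or_eq with hz_lt | hz_eq
  · have hbottom := hasSimplePoleAt_latticeZeta_mul_sub_cotPi (a := x) hw hper
      (by simpa [abs_of_nonneg hz_nonneg]) (zero_mem (unitPeriods δ hδ).lattice)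
    have htop := hasSimplePoleAt_const_mul_cotPi_sub (a := x + δ) (w (x + δ))
      (by simpa using (sub_neg.2 hz_lt).ne)
    simpa only [add_zero, sub_zero] using hbottom.sub htop
  · have htop := hasSimplePoleAt_latticeZeta_mul_sub_cotPi (a := x + δ) hw hper
      (by simpa [hz_eq]) (period_mem_lattice (hδ := hδ))
    have hbottom := hasSimplePoleAt_const_mul_cotPi_sub (a := x) (z := z) (w x)
      (by simpa [hz_eq] using hδ.ne')
    rw [← sub_zero (0 : ℂ)]
    refine (htop.sub hbottom).congr (.of_forall fun y => ?_)
    rw [sub_right_comm, sub_add_eq_sub_sub, sub_add_cancel]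

theorem hasSimplePoleAt_discreteLaplacian_mul_sub_cotPi (hγ_pos : 0 < γ.im) (hγ_lt : γ.im < δ.im)
    {z : ℂ} (hw : AnalyticAt ℂ w z) (hper : Function.Periodic w 1) (hz_nonneg : 0 ≤ z.im)
    (hz_le : z.im ≤ δ.im) :
    HasSimplePoleAt (fun z => discreteLaplacian γ (latticeZeta (unitPeriods δ hδ)) (z - x) * w z
      - (w (x + γ) * cotPi (z - (x + γ)) + w (x + δ - γ) * cotPi (z - (x + δ - γ))
        + -2 * w x * cotPi (z - x) + -2 * w (x + δ) * cotPi (z - (x + δ)))) 0 z := by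
  have hsub := hasSimplePoleAt_latticeZeta_mul_sub_cotPi (a := x + γ) hw hper
    (by simpa [abs_lt] using ⟨by linarith, by linarith⟩) (zero_mem (unitPeriods δ hδ).lattice)
  have hadd := hasSimplePoleAt_latticeZeta_mul_sub_cotPi (a := x + δ - γ) hw hper
    (by simpa [abs_lt] using ⟨by linarith, by linarith⟩) (period_mem_lattice (hδ := hδ))
  have hmid := hasSimplePoleAt_latticeZeta_mul_sub_boundary_cotPi (hδ := hδ) (x := x) hw hper
    hz_nonneg hz_le
  have hsum := (hsub.add hadd).sub (hmid.const_mul 2)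
  rw [add_zero, mul_zero, sub_zero] at hsum
  refine hsum.congr (.of_forall fun y => ?_)
  rw [discreteLaplacian, sub_sub, show y - (x + δ - γ) + δ = y - x + γ by ring, add_zero]
  ring

theorem analyticAt_discreteLaplacian_mul {z : ℂ} (hw : AnalyticAt ℂ w z)
    (hz : z - x ∉ laplacianPoles (unitPeriods δ hδ) γ) :
    AnalyticAt ℂ
      (fun z => discreteLaplacian γ (latticeZeta (unitPeriods δ hδ)) (z - x) * w z) z :=
  ((analyticAt_discreteLaplacian_latticeZeta hz).fun_comp (f := fun z : ℂ => z - x)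
    (by fun_prop)).fun_mul hw

theorem ofReal_sub_notMem_laplacianPoles (hγ_pos : 0 < γ.im) (hγ_lt : γ.im < δ.im) {y : ℝ}
    (hy : ∀ n : ℤ, y ≠ x + n) : (y : ℂ) - x ∉ laplacianPoles (unitPeriods δ hδ) γ := by
  rw [← ofReal_sub]
  exact ofReal_notMem_laplacianPoles hγ_pos hγ_lt fun n hn => hy n (eq_add_of_sub_eq' hn)

/-- The residues at `x + γ` and `x + δ - γ`, inside the strip, are `w (x + γ)` and `w (x + δ - γ)`;
those at the boundary points `x` and `x + δ` are `-2 w x` and `-2 w (x + δ)`. -/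
theorem hasPrincipalValue_discreteLaplacian_mul_sub (hγ_pos : 0 < γ.im) (hγ_lt : γ.im < δ.im)
    (hper : Function.Periodic w 1)
    (hw : ∀ z : ℂ, 0 ≤ z.im → z.im ≤ δ.im → AnalyticAt ℂ w z) :
    HasPrincipalValue x (fun y =>
        discreteLaplacian γ (latticeZeta (unitPeriods δ hδ)) (y - x) * (w y - w (y + δ)))
      (2 * Real.pi * I * (w (x + γ) + w (x + δ - γ) - w x - w (x + δ))) := by
  set L := unitPeriods δ hδ
  set F : ℂ → ℂ := fun z => discreteLaplacian γ (latticeZeta L) (z - x) * w z with hF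
  have hF_periodic : ∀ z, ∀ᶠ y in 𝓝[≠] z, F (y + 1) = F y := fun z => by
    filter_upwards [eventually_add_notMem_laplacianPoles (L := L) γ (-x) z] with y hy
    simp only [hF]
    rw [← sub_eq_add_neg] at hy
    rw [hper, add_sub_right_comm, discreteLaplacian_latticeZeta_add one_mem_lattice hy]
  have hnotMem : ∀ {y : ℝ}, (∀ n : ℤ, y ≠ x + n) → (y : ℂ) - x ∉ laplacianPoles L γ :=
    ofReal_sub_notMem_laplacianPoles hγ_pos hγ_lt
  have hF_cont : ∀ y : ℝ, (∀ n : ℤ, y ≠ x + n) → ContinuousAt F y ∧ ContinuousAt F (y + δ) := by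
    refine fun y hy => ⟨(analyticAt_discreteLaplacian_mul (hw _ (by simp) (by simpa using hδ.le))
      (hnotMem hy)).continuousAt, (analyticAt_discreteLaplacian_mul (hw _ (by simpa using hδ.le)
      (by simp)) ?_).continuousAt⟩
    rw [add_sub_right_comm]
    exact mt (add_mem_laplacianPoles_iff period_mem_lattice).1 (hnotMem hy)
  have hresidues := hasPrincipalValue_sub_add_of_simplePoles (F := F) (x := x)
    (c := ![w (x + γ), w (x + δ - γ), -2 * w x, -2 * w (x + δ)])
    (p := ![x + γ, x + δ - γ, x, x + δ]) hδ.le hF_periodic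
    (fun z hz_nonneg hz_le => by
      simpa [Fin.sum_univ_four] using hasSimplePoleAt_discreteLaplacian_mul_sub_cotPi hγ_pos hγ_lt
        (hw z hz_nonneg hz_le) hper hz_nonneg hz_le)
    hF_cont
    (by simp [Fin.forall_fin_succ, hγ_pos.ne', hδ.ne', (sub_pos.2 hγ_lt).ne'])
    (by simp [Fin.forall_fin_succ, hγ_pos.ne', hδ.ne, hγ_lt.ne])
  convert hresidues.congr fun y hy => ?_ using 1
  · simp only [Fin.sum_univ_four, Matrix.cons_val, add_im, sub_im, ofReal_im, zero_add, sub_zero,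
      sub_self, sub_sub_cancel, Real.sign_of_pos hγ_pos, Real.sign_of_pos (sub_pos.2 hγ_lt),
      Real.sign_of_pos hδ, Real.sign_zero, ofReal_one, ofReal_zero]
    ring
  · simp only [hF]
    rw [add_sub_right_comm, discreteLaplacian_latticeZeta_add period_mem_lattice (hnotMem hy),
      mul_sub]

theorem hasPrincipalValue_discreteLaplacian (hγ_pos : 0 < γ.im) (hγ_lt : γ.im < δ.im) :
    HasPrincipalValue x
      (fun y => discreteLaplacian γ (latticeZeta (unitPeriods δ hδ)) (y - x)) 0 := by
  set L := unitPeriods δ hδ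
  refine hasPrincipalValue_of_odd (fun y hy => ?_) (fun y hy => ?_) (fun y _ => ?_)
  · exact ContinuousAt.comp' (g := discreteLaplacian γ (latticeZeta L))
      (f := fun y : ℝ => (y : ℂ) - x) (analyticAt_discreteLaplacian_latticeZeta
        (ofReal_sub_notMem_laplacianPoles hγ_pos hγ_lt hy)).continuousAt (by fun_prop)
  · rw [ofReal_add, ofReal_one, add_sub_right_comm, discreteLaplacian_latticeZeta_add
      one_mem_lattice (ofReal_sub_notMem_laplacianPoles hγ_pos hγ_lt hy)]
  · rw [← discreteLaplacian_neg (latticeZeta_neg L)]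
    push_cast
    ring_nf

theorem hasTransform_sub_add {ω₁ ω₂ : ℂ} (hδ : 0 < (ω₂ / ω₁).im) (hγ_pos : 0 < γ.im)
    (hγ_lt : γ.im < (ω₂ / ω₁).im) (hper : Function.Periodic w 1)
    (hw : ∀ z : ℂ, 0 ≤ z.im → z.im ≤ (ω₂ / ω₁).im → AnalyticAt ℂ w z) (c : ℂ) (x : ℝ) :
    HasTransform ω₁ ω₂ γ (fun y => w y - w (y + ω₂ / ω₁) + c) x
      (w x + w (x + ω₂ / ω₁) - w (x + γ) - w (x + ω₂ / ω₁ - γ)) := by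
  have hω₁ : ω₁ ≠ 0 := by
    rintro rfl
    simp at hδ
  have hpv := ((hasPrincipalValue_discreteLaplacian_mul_sub (hδ := hδ) hγ_pos hγ_lt hper hw).add
    ((hasPrincipalValue_discreteLaplacian (hδ := hδ) (x := x) hγ_pos hγ_lt).const_mul c)).const_mul
      (1 / (2 * ω₁))
  refine ⟨_, hpv.congr fun y _ => ?_, ?_⟩
  · rw [kernel_eq_discreteLaplacian hδ]
    ring
  · have hpi : (Real.pi : ℂ) ≠ 0 := ofReal_ne_zero.2 Real.pi_ne_zero
    generalize ω₂ / ω₁ = δ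
    field_simp
    linear_combination -2 * Real.pi * (w (x + γ) + w (x + δ - γ) - w x - w (x + δ)) * I_sq

end Transform

/-! ### The solution -/

section Solution

variable {ω₁ ω₂ γ δ ε Δ η₀ : ℂ} {k : ℤ}

/-- The function `w = -∂_t τ / τ`, through which `η` is written as a difference of boundary values
on the strip. -/
noncomputable def tauLogDeriv (γ δ ε Δ : ℂ) (k : ℤ) (t z : ℂ) : ℂ :=
  -(omega γ δ ε Δ k * theta1' (k * z + omega γ δ ε Δ k * t) Δ / tau γ δ ε Δ k z t)

theorem tauLogDeriv_periodic (t : ℂ) : Function.Periodic (tauLogDeriv γ δ ε Δ k t) 1 := by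
  have hlogDeriv : Function.Periodic (fun u => theta1' u Δ / theta1 u Δ) 1 := fun u => by
    simp only [theta1_add_one, theta1'_add_one, neg_one_mul, neg_div_neg_eq]
  intro z
  have hshift := hlogDeriv.int_mul k (k * z + omega γ δ ε Δ k * t)
  simp only [mul_one] at hshift
  simp only [tauLogDeriv, tau, mul_div_assoc]
  rw [← hshift, mul_add, mul_one, add_right_comm]

theorem analyticAt_tauLogDeriv (hΔ : 0 < Δ.im) {t z : ℂ} (hτ : tau γ δ ε Δ k z t ≠ 0) :
    AnalyticAt ℂ (tauLogDeriv γ δ ε Δ k t) z := by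
  have htau := (differentiable_tau (γ := γ) (δ := δ) (ε := ε) (k := k) hΔ t).analyticAt z
  have hderiv : AnalyticAt ℂ (fun z : ℂ => theta1' (k * z + omega γ δ ε Δ k * t) Δ) z :=
    ((differentiable_theta1' hΔ).analyticAt _).fun_comp
      (f := fun z : ℂ => (k : ℂ) * z + omega γ δ ε Δ k * t) (by fun_prop)
  unfold tauLogDeriv
  fun_prop (disch := assumption)

theorem eta_eq_tauLogDeriv_sub (hΔ : 0 < Δ.im)
    (hbilinear : IsBilinearSolution γ δ ε η₀ (tau γ δ ε Δ k)) {x t : ℂ}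
    (hτ : tau γ δ ε Δ k x t ≠ 0) (hτδ : tau γ δ ε Δ k (x + δ) t ≠ 0) :
    eta γ δ ε Δ k x t = tauLogDeriv γ δ ε Δ k t x - tauLogDeriv γ δ ε Δ k t (x + δ) + η₀ := by
  have hequation := hbilinear.equation x t
  rw [hirotaD, (hasDerivAt_tau hΔ _ _).deriv, (hasDerivAt_tau hΔ _ _).deriv] at hequation
  simp only [eta, tauLogDeriv]
  generalize theta1' (k * x + omega γ δ ε Δ k * t) Δ = θ' at *
  generalize theta1' (k * (x + δ) + omega γ δ ε Δ k * t) Δ = θδ' at *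
  field_simp
  linear_combination -hequation

theorem hasDerivAt_eta (hΔ : 0 < Δ.im) {x t : ℂ} (hτ : tau γ δ ε Δ k x t ≠ 0)
    (hτδ : tau γ δ ε Δ k (x + δ) t ≠ 0) (hτγ : tau γ δ ε Δ k (x + γ) t ≠ 0)
    (hτδγ : tau γ δ ε Δ k (x + δ - γ) t ≠ 0) :
    HasDerivAt (eta γ δ ε Δ k x) (eta γ δ ε Δ k x t *
      (tauLogDeriv γ δ ε Δ k t x + tauLogDeriv γ δ ε Δ k t (x + δ)
        - tauLogDeriv γ δ ε Δ k t (x + γ) - tauLogDeriv γ δ ε Δ k t (x + δ - γ))) t := by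
  have htau := fun y => hasDerivAt_tau (γ := γ) (δ := δ) (ε := ε) (k := k) hΔ y t
  refine ((((htau (x + δ - γ)).fun_mul (htau (x + γ))).fun_div
    ((htau (x + δ)).fun_mul (htau x)) (mul_ne_zero hτδ hτ)).const_mul ε).congr_deriv ?_
  simp only [eta, tauLogDeriv]
  field_simp
  ring

theorem analyticAt_tau_ofReal_add (hΔ : 0 < Δ.im) (c : ℂ) (p : ℝ × ℂ) :
    AnalyticAt ℝ (fun p : ℝ × ℂ => tau γ δ ε Δ k (p.1 + c) p.2) p := by
  have hspace : AnalyticAt ℝ (fun p : ℝ × ℂ => (p.1 : ℂ)) p :=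
    (ofRealCLM.analyticAt p.1).fun_comp (f := fun p : ℝ × ℂ => p.1) analyticAt_fst
  have hphase : AnalyticAt ℝ
      (fun p : ℝ × ℂ => (k : ℂ) * (p.1 + c) + omega γ δ ε Δ k * p.2) p :=
    (analyticAt_const.fun_mul (hspace.fun_add analyticAt_const)).fun_add
      (analyticAt_const.fun_mul analyticAt_snd)
  exact (((differentiable_theta1 hΔ).analyticAt _).restrictScalars (𝕜 := ℝ)).fun_comp
    (f := fun p : ℝ × ℂ => (k : ℂ) * (p.1 + c) + omega γ δ ε Δ k * p.2) hphase

theorem analyticAt_eta (hΔ : 0 < Δ.im) {x : ℝ} {t : ℂ} (hτ : tau γ δ ε Δ k x t ≠ 0)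
    (hτδ : tau γ δ ε Δ k (x + δ) t ≠ 0) :
    AnalyticAt ℝ (fun p : ℝ × ℂ => eta γ δ ε Δ k p.1 p.2) (x, t) := by
  have htau := analyticAt_tau_ofReal_add (γ := γ) (δ := δ) (ε := ε) (k := k) hΔ (p := (x, t))
  have htau_zero := htau 0
  simp only [add_zero] at htau_zero
  unfold eta
  simp only [add_sub_assoc]
  exact analyticAt_const.fun_mul (((htau (δ - γ)).fun_mul (htau γ)).fun_div
    ((htau δ).fun_mul htau_zero) (mul_ne_zero hτδ hτ))

theorem ne_zero_of_mem_regularTimes {τ : ℂ → ℂ → ℂ} {x : ℝ} {t c : ℂ}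
    (ht : t ∈ regularTimes δ τ) (hc_nonneg : 0 ≤ c.im) (hc_le : c.im ≤ δ.im) :
    τ (x + c) t ≠ 0 :=
  ht _ (by simpa using hc_nonneg) (by simpa using hc_le)

theorem hasTransform_eta (hδ : δ = ω₂ / ω₁) (hγ_pos : 0 < γ.im) (hγ_lt : γ.im < δ.im)
    (hΔ : 0 < Δ.im) (hbilinear : IsBilinearSolution γ δ ε η₀ (tau γ δ ε Δ k)) {t : ℂ}
    (ht : t ∈ regularTimes δ (tau γ δ ε Δ k)) (x : ℝ) :
    HasTransform ω₁ ω₂ γ (fun y => eta γ δ ε Δ k y t) x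
      (tauLogDeriv γ δ ε Δ k t x + tauLogDeriv γ δ ε Δ k t (x + δ)
        - tauLogDeriv γ δ ε Δ k t (x + γ) - tauLogDeriv γ δ ε Δ k t (x + δ - γ)) := by
  have hδ_pos : 0 < δ.im := hγ_pos.trans hγ_lt
  have heta : (fun y : ℝ => eta γ δ ε Δ k y t) = fun y : ℝ =>
      tauLogDeriv γ δ ε Δ k t y - tauLogDeriv γ δ ε Δ k t (y + δ) + η₀ :=
    funext fun y => eta_eq_tauLogDeriv_sub hΔ hbilinear (ht y (by simp) (by simpa using hδ_pos.le))
      (ne_zero_of_mem_regularTimes ht hδ_pos.le le_rfl)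
  have hanalytic : ∀ z : ℂ, 0 ≤ z.im → z.im ≤ δ.im →
      AnalyticAt ℂ (tauLogDeriv γ δ ε Δ k t) z :=
    fun z hz_nonneg hz_le => analyticAt_tauLogDeriv hΔ (ht z hz_nonneg hz_le)
  have hper := tauLogDeriv_periodic (γ := γ) (δ := δ) (ε := ε) (Δ := Δ) (k := k) t
  rw [heta]
  generalize tauLogDeriv γ δ ε Δ k t = w at *
  subst hδ
  exact hasTransform_sub_add hδ_pos hγ_pos hγ_lt hper hanalytic η₀ x

theorem isILWSolution_eta (hδ : δ = ω₂ / ω₁) (hγ_pos : 0 < γ.im) (hγ_lt : γ.im < δ.im)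
    (hΔ : 0 < Δ.im) (hk : k ≠ 0) (hbilinear : IsBilinearSolution γ δ ε η₀ (tau γ δ ε Δ k)) :
    IsILWSolution ω₁ ω₂ γ (regularTimes δ (tau γ δ ε Δ k)) (fun x t => eta γ δ ε Δ k x t) := by
  have hδ_pos : 0 < δ.im := hγ_pos.trans hγ_lt
  have hτ : ∀ t ∈ regularTimes δ (tau γ δ ε Δ k), ∀ x : ℝ, tau γ δ ε Δ k x t ≠ 0 :=
    fun t ht x => ht x (by simp) (by simpa using hδ_pos.le)
  refine ⟨fun x t ht => analyticAt_eta hΔ (hτ t ht x)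
    (ne_zero_of_mem_regularTimes ht hδ_pos.le le_rfl), fun x t _ => ?_, fun x t ht =>
    ⟨_, hasTransform_eta hδ hγ_pos hγ_lt hΔ hbilinear ht x, hasDerivAt_eta hΔ (hτ t ht x)
      (ne_zero_of_mem_regularTimes ht hδ_pos.le le_rfl)
      (ne_zero_of_mem_regularTimes ht hγ_pos.le hγ_lt.le) ?_⟩⟩
  · rw [ofReal_add, ofReal_one]
    exact (eta_periodic hΔ hk t).1 x
  · rw [add_sub_assoc]
    exact ne_zero_of_mem_regularTimes ht (by simpa using hγ_lt.le) (by simpa using hγ_pos.le)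

theorem theta1_ne_zero_of_forall_ne (hΔ : 0 < Δ.im) {u : ℂ} (hu : ∀ m n : ℤ, u ≠ m + n * Δ) :
    theta1 u Δ ≠ 0 := fun h => by
  obtain ⟨m, n, hmn⟩ := mem_lattice_unitPeriods.1 ((theta1_eq_zero_iff hΔ).1 h)
  exact hu m n hmn

end Solution

end EllipticILW

open EllipticILW in
theorem mainTheorem2_general (ω₁ ω₂ γ δ ε Δ : ℂ) (k : ℤ)
    (hδ : δ = ω₂ / ω₁) (hγ_pos : 0 < γ.im) (hγ_lt : γ.im < δ.im) (hΔ : 0 < Δ.im)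
    (hkγ : ∀ m n : ℤ, (k : ℂ) * γ ≠ m + n * Δ)
    (hkδ : ∀ m n : ℤ, (k : ℂ) * δ ≠ m + n * Δ)
    (hkδγ : ∀ m n : ℤ, (k : ℂ) * (δ - γ) ≠ m + n * Δ) :
    IsBilinearSolution γ δ ε (etaZero γ δ ε Δ k) (tau γ δ ε Δ k) ∧
    (∀ t : ℂ, Meromorphic (fun z => eta γ δ ε Δ k z t) ∧
      Function.Periodic (fun z => eta γ δ ε Δ k z t) 1 ∧
      Function.Periodic (fun z => eta γ δ ε Δ k z t) (Δ / k)) ∧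
    IsILWSolution ω₁ ω₂ γ (regularTimes δ (tau γ δ ε Δ k)) (fun x t => eta γ δ ε Δ k x t) ∧
    IsOpen (regularTimes δ (tau γ δ ε Δ k)) ∧
    (ε ≠ 0 → |(k : ℝ)| * δ.im < Δ.im → (regularTimes δ (tau γ δ ε Δ k)).Nonempty) := by
  have hk : k ≠ 0 := by
    rintro rfl
    exact hkγ 0 0 (by simp)
  have hθγ := theta1_ne_zero_of_forall_ne hΔ hkγ
  have hθδ := theta1_ne_zero_of_forall_ne hΔ hkδ
  have hθδγ := theta1_ne_zero_of_forall_ne hΔ hkδγ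
  have hbilinear := isBilinearSolution_tau (ε := ε) hΔ hθγ hθδ hθδγ
  refine ⟨hbilinear, fun t => ⟨meromorphic_eta hΔ t, eta_periodic hΔ hk t⟩,
    isILWSolution_eta hδ hγ_pos hγ_lt hΔ hk hbilinear, isOpen_regularTimes hΔ,
    fun hε hkδ_lt => regularTimes_nonempty hΔ ?_ hkδ_lt⟩
  exact mul_ne_zero (neg_ne_zero.2 hε) (div_ne_zero (mul_ne_zero hθγ hθδγ)
    (mul_ne_zero (theta1'_ne_zero hΔ (theta1_zero Δ)) hθδ))

open EllipticILW in
theorem mainTheorem2 (ω₁ ω₂ γ δ ε Δ : ℂ) (k : ℤ)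
    (hδ : δ = ω₂ / ω₁) (hδ_pos : 0 < δ.im) (hγ_pos : 0 < γ.im) (hγ_lt : γ.im < δ.im)
    (hΔ : δ.im < Δ.im) (hk : k ≠ 0)
    (hkγ : ∀ m n : ℤ, (k : ℂ) * γ ≠ m + n * Δ)
    (hkδ : ∀ m n : ℤ, (k : ℂ) * δ ≠ m + n * Δ)
    (hkδγ : ∀ m n : ℤ, (k : ℂ) * (δ - γ) ≠ m + n * Δ) :
    IsBilinearSolution γ δ ε (etaZero γ δ ε Δ k) (tau γ δ ε Δ k) ∧
    (∀ t : ℂ, Meromorphic (fun z => eta γ δ ε Δ k z t) ∧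
      Function.Periodic (fun z => eta γ δ ε Δ k z t) 1 ∧
      Function.Periodic (fun z => eta γ δ ε Δ k z t) (Δ / k)) ∧
    IsILWSolution ω₁ ω₂ γ (regularTimes δ (tau γ δ ε Δ k)) (fun x t => eta γ δ ε Δ k x t) ∧
    IsOpen (regularTimes δ (tau γ δ ε Δ k)) ∧
    (ε ≠ 0 → |(k : ℝ)| * δ.im < Δ.im → (regularTimes δ (tau γ δ ε Δ k)).Nonempty) :=
  mainTheorem2_general ω₁ ω₂ γ δ ε Δ k hδ hγ_pos hγ_lt (hδ_pos.trans hΔ) hkγ hkδ hkδγ
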